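/- Let $(\Omega,\mathcal F,\{\mathcal F_s\}_{s\ge 0},\mathbb P)$ be a filtered probability space satisfying the usual hypothesis (right-continuous, $\mathcal F_0$ contains all $\mathbb P$-null sets), let $t>0$, and let $\{D_k\}_k$ be a refining sequence of $[0,t]$, i.e. a sequence of finite deterministic partitions $0=t_0<\dots<t_m=t$ whose mesh tends to $0$ as $k\to\infty$. For a path $Y$, put $\Delta Y_u=Y_u-Y_{u-}$ ($\Delta Y_0=0$). An adapted cadlag process $Y$ is said to admit a (weak sense) quadratic variation $[Y]$ along $\{D_k\}_k$ if there is an adapted, continuous, increasing process $[Y]^c$ on $[0,t]$ such that, for $[Y]_s=[Y]^c_s+\sum_{u\le s}(\Delta Y_u)^2$, $$\sum_{t_i\in D_k,\ t_i\le s}\left(Y_{t_{i+1}}-Y_{t_i}\right)^2\xrightarrow{\ \mathbb P\ }[Y]_s\quad (k\to\infty)\qquad\text{for every } 0<s\le t,$$ where $t_{i+1}$ is read as $s$ if $t_i=s$. Write $Y^*_t=\sup_{s\le t}|Y_s|$. Let $X$ and $X^n$ ($n\in\mathbb N$) be adapted cadlag processes such that $X$, all $X^n$ and all $X^n-X$ admit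 quadratic variations along the same refining sequence $\{D_k\}_k$. Suppose that 1. $[X^n-X]_t\to 0$ almost surely; 2. almost surely, $X^n_s\to X_s$ for all $s\le t$; 3. the sequence $\{(X^n)^*_t\}_n$ is, as a whole, bounded in probability: $\lim_{R\to\infty}\mathbb P\left(\sup_n (X^n)^*_t\le R\right)=1$. Then for every $f\in C^2(\mathbb R)$, each $f(X^n)-f(X)$ admits a quadratic variation along $\{D_k\}_k$, and $$[f(X^n)-f(X)]_t\to 0\quad\text{almost surely.}$$ -/

import Mathlib

open MeasureTheory Filter Topology
open scoped NNReal ENNReal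

noncomputable section

/-- The usual hypothesis: the filtration is right-continuous and `𝓕 0` contains every
`P`-null set. -/
structure UsualHypothesis {Ω : Type*} [mΩ : MeasurableSpace Ω] (P : Measure Ω)
    (𝓕 : Filtration ℝ≥0 mΩ) : Prop where
  rightContinuous : 𝓕.IsRightContinuous
  complete : ∀ A : Set Ω, P A = 0 → MeasurableSet[𝓕 0] A

/-- A path is cadlag: right-continuous with (finite) left limits. At time `0` the left limit
carries no condition. -/
def IsCadlag (x : ℝ≥0 → ℝ) : Prop :=
  ∀ s, ContinuousWithinAt x (Set.Ici s) s ∧ ∃ l, Tendsto x (𝓝[<] s) (𝓝 l)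

/-- `X` is an adapted process with (almost surely) cadlag paths. -/
structure IsCadlagProcess {Ω : Type*} [mΩ : MeasurableSpace Ω] (P : Measure Ω)
    (𝓕 : Filtration ℝ≥0 mΩ) (X : ℝ≥0 → Ω → ℝ) : Prop where
  adapted : Adapted 𝓕 X
  cadlag : ∀ᵐ ω ∂P, IsCadlag (fun s => X s ω)

/-- The jump `Δx_u = x_u - x_{u-}` of a path. It is `0` at `u = 0`. -/
def jump (x : ℝ≥0 → ℝ) (u : ℝ≥0) : ℝ := x u - Function.leftLim x u

/-- A finite (deterministic) partition `0 = p 0 < p 1 < ... < p n = t` of `[0, t]`. The values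
`p i` for `i > n` play no role. -/
structure TimePartition (t : ℝ≥0) where
  n : ℕ
  p : ℕ → ℝ≥0
  first : p 0 = 0
  last : p n = t
  lt_succ : ∀ i < n, p i < p (i + 1)

/-- The mesh `max_i (p (i+1) - p i)`. -/
def TimePartition.mesh {t : ℝ≥0} (D : TimePartition t) : ℝ≥0 :=
  (Finset.range D.n).sup fun i => D.p (i + 1) - D.p i

/-- A refining sequence of `[0, t]`: a sequence of partitions whose mesh tends to zero. -/
def IsRefining {t : ℝ≥0} (D : ℕ → TimePartition t) : Prop :=
  Tendsto (fun k => (D k).mesh) atTop (𝓝 0)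

/-- The sum `∑_{t_i ∈ D, t_i ≤ s} (x_{t_{i+1}} - x_{t_i})²`, for `s ≤ t`, with the convention that
`t_{i+1} = s` if `t_i = s`. -/
def TimePartition.sqSum {t : ℝ≥0} (D : TimePartition t) (x : ℝ≥0 → ℝ) (s : ℝ≥0) : ℝ :=
  ∑ i ∈ (Finset.range (D.n + 1)).filter (fun i => D.p i ≤ s),
    (x (if D.p i = s then s else D.p (i + 1)) - x (D.p i)) ^ 2

/-- `Q` is (a version of) the quadratic variation `[X]` of `X`, in the weak sense, on `[0, t]`
along the sequence of partitions `D`: there is an adapted, continuous, increasing process `Qc`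
(the continuous part `[X]^c`) with `Q_s = Qc_s + ∑_{u ≤ s} (ΔX_u)²` for all `0 < s ≤ t` almost
surely (the sum of squared jumps being convergent), and for every `0 < s ≤ t` the sums of squared
increments of `X` up to time `s` along `D k` tend to `Q_s` in probability as `k → ∞`. -/
structure IsQuadVar {Ω : Type*} [mΩ : MeasurableSpace Ω] (P : Measure Ω)
    (𝓕 : Filtration ℝ≥0 mΩ) {t : ℝ≥0} (D : ℕ → TimePartition t)
    (X Q : ℝ≥0 → Ω → ℝ) : Prop where
  adapted : Adapted 𝓕 Q
  decomp : ∃ Qc : ℝ≥0 → Ω → ℝ, Adapted 𝓕 Qc ∧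
    ∀ᵐ ω ∂P, ContinuousOn (fun s => Qc s ω) (Set.Icc 0 t) ∧
      MonotoneOn (fun s => Qc s ω) (Set.Icc 0 t) ∧
      ∀ s ∈ Set.Ioc 0 t,
        HasSum (fun u : Set.Icc 0 s => (jump (fun r => X r ω) u) ^ 2) (Q s ω - Qc s ω)
  tendsto : ∀ s ∈ Set.Ioc 0 t,
    TendstoInMeasure P (fun k ω => (D k).sqSum (fun r => X r ω) s) atTop (Q s)

/-- `X` admits a quadratic variation, in the weak sense, on `[0, t]` along `D`. -/
def HasQuadVar {Ω : Type*} [mΩ : MeasurableSpace Ω] (P : Measure Ω)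
    (𝓕 : Filtration ℝ≥0 mΩ) {t : ℝ≥0} (D : ℕ → TimePartition t)
    (X : ℝ≥0 → Ω → ℝ) : Prop :=
  ∃ Q : ℝ≥0 → Ω → ℝ, IsQuadVar P 𝓕 D X Q

/-- The supremum process `X^*_t = sup_{s ≤ t} |X_s|`, with values in `[0, ∞]`. -/
def supProcess {Ω : Type*} (X : ℝ≥0 → Ω → ℝ) (t : ℝ≥0) (ω : Ω) : ℝ≥0∞ :=
  ⨆ s ∈ Set.Icc 0 t, ‖X s ω‖ₑ

/-- The sequence `Z` of `[0, ∞]`-valued random variables is, as a whole, bounded in probability: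
`P (sup_n Z_n ≤ R) → 1` as `R → ∞`. -/
def SeqBoundedInProbability {Ω : Type*} [MeasurableSpace Ω] (P : Measure Ω)
    (Z : ℕ → Ω → ℝ≥0∞) : Prop :=
  Tendsto (fun R : ℝ≥0 => P {ω | (⨆ n, Z n ω) ≤ (R : ℝ≥0∞)}) atTop (𝓝 1)

end

/-! The statement is reduced to single paths. Convergence in probability at a countable dense set of
times becomes almost sure convergence along a subsequence of the partitions. Monotonicity of the
sums and the known jumps of the limit extend it to all times (`exists_seq_isPathQuadVar`), so that
`x`, `y`, `w = y - x` have pathwise quadratic variations.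

Existence for `z = f y - f x`: just before or just after any time, `dz²` differs from `(A dy - B
dx)²` by at most `ε (dx² + dy²)`, with constants `A`, `B`. By polarization the sums of the latter
converge. Interval induction glues the local statements, so the sums of `dz²` are Cauchy
(`exists_tendsto_comp_sub`). A Fatou argument for jumps, applied to `dz²` and to `K (dx² + dy²) -
dz²`, shows that the limit minus its squared jumps is increasing and continuous
(`isJumpDecomp_contPart`). The usual hypothesis gives adaptedness, and the limit is the same along
all subsequences, whence convergence in probability (`HasQuadVar.comp_sub`).

Convergence to zero: since `f` is `C²`, on bounded sets `dz² ≤ K (dw² + w² dx²)` with `w` taken at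
the left endpoint. In the limit `[z]_t ≤ K ([w]_t + ∫ w₋² d[x])`, up to a possible mass of `[x]` at
time `0`. The first term vanishes by hypothesis. In the second, `w₋ → 0` pointwise because `w → 0`
and `(Δw)² ≤ [w]_t → 0`, and dominated convergence applies because boundedness in probability of the
whole sequence bounds almost every path uniformly in `n` (`tendsto_zero_of_isPathQuadVar`). -/

/-- A transitive relation that holds between each point and the points close to it, on either
side, holds between the endpoints of an interval. -/
theorem interval_induction {R : ℝ≥0 → ℝ≥0 → Prop} {a b : ℝ≥0} (hab : a < b)
    (trans : ∀ x y z, x < y → y < z → R x y → R y z → R x z)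
    (right : ∀ s, a ≤ s → s < b → ∃ s₁ > s, ∀ r, s < r → r < s₁ → r ≤ b → R s r)
    (left : ∀ s, a < s → s ≤ b → ∃ s₀ < s, ∀ r, s₀ < r → r < s → a ≤ r → R r s) : R a b := by
  set A : Set ℝ≥0 := {s | a < s ∧ s ≤ b ∧ R a s}
  have hbdd : BddAbove A := ⟨b, fun s hs => hs.2.1⟩
  obtain ⟨s₁, hs₁, h₁⟩ := right a le_rfl hab
  obtain ⟨r, hr1, hr2⟩ := exists_between (lt_min hs₁ hab)
  have hrA : r ∈ A := ⟨hr1, (hr2.trans_le (min_le_right _ _)).le,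
    h₁ r hr1 (hr2.trans_le (min_le_left _ _)) (hr2.trans_le (min_le_right _ _)).le⟩
  -- The left condition at `σ` puts `σ` itself in `A`; the right condition then rules out `σ < b`.
  set σ := sSup A
  have hσb : σ ≤ b := csSup_le ⟨r, hrA⟩ fun s hs => hs.2.1
  have haσ : a < σ := hr1.trans_le (le_csSup hbdd hrA)
  have hRσ : R a σ := by
    obtain ⟨s₀, hs₀, h₀⟩ := left σ haσ hσb
    obtain ⟨q, hqA, hq⟩ := exists_lt_of_lt_csSup ⟨r, hrA⟩ hs₀
    rcases (le_csSup hbdd hqA).lt_or_eq with h | h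
    · exact trans a q σ hqA.1 h hqA.2.2 (h₀ q hq h hqA.1.le)
    · rw [show σ = q from h.symm]; exact hqA.2.2
  rcases hσb.lt_or_eq with h | h
  · exfalso
    obtain ⟨s₁, hs₁, h₁⟩ := right σ haσ.le h
    obtain ⟨q, hq1, hq2⟩ := exists_between (lt_min hs₁ h)
    have hqb := (hq2.trans_le (min_le_right _ _)).le
    have hqA : q ∈ A := ⟨haσ.trans hq1, hqb,
      trans a σ q haσ hq1 hRσ (h₁ q hq1 (hq2.trans_le (min_le_left _ _)) hqb)⟩
    exact absurd (le_csSup hbdd hqA) (not_le.2 hq1)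
  · exact h ▸ hRσ

/-! ### Sums over a partition -/

namespace TimePartition

variable {t : ℝ≥0} (D : TimePartition t)

/-- The sum of `c (t_i) (t_{i+1})` over the intervals of the partition with `a ≤ t_i < b`. -/
noncomputable def incrSum (c : ℝ≥0 → ℝ≥0 → ℝ) (a b : ℝ≥0) : ℝ :=
  ∑ i ∈ (Finset.range D.n).filter (fun i => a ≤ D.p i ∧ D.p i < b), c (D.p i) (D.p (i + 1))

theorem p_strictMono {i j : ℕ} (hij : i < j) (hj : j ≤ D.n) : D.p i < D.p j := by
  induction j, hij using Nat.le_induction with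
  | base => exact D.lt_succ i (by omega)
  | succ k hk ih => exact (ih (by omega)).trans (D.lt_succ k (by omega))

theorem p_mono {i j : ℕ} (hij : i ≤ j) (hj : j ≤ D.n) : D.p i ≤ D.p j := by
  rcases hij.eq_or_lt with rfl | h
  · exact le_rfl
  · exact (D.p_strictMono h hj).le

theorem p_le {i : ℕ} (hi : i ≤ D.n) : D.p i ≤ t :=
  (D.p_mono hi le_rfl).trans_eq D.last

theorem p_succ_le {i : ℕ} (hi : i < D.n) : D.p (i + 1) ≤ D.p i + D.mesh := by
  have h : D.p (i + 1) - D.p i ≤ D.mesh :=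
    Finset.le_sup (f := fun i => D.p (i + 1) - D.p i) (Finset.mem_range.2 hi)
  exact tsub_le_iff_left.1 h

theorem incrSum_zero_eq (c : ℝ≥0 → ℝ≥0 → ℝ) (s : ℝ≥0) :
    D.incrSum c 0 s =
      ∑ i ∈ (Finset.range D.n).filter (fun i => D.p i < s), c (D.p i) (D.p (i + 1)) := by
  simp [incrSum]

/-- A term with `t_i = s` vanishes by the convention on `t_{i+1}`, and the extra index `D.n` is
selected only if `s = t`, where the same applies. -/
theorem sqSum_eq_incrSum (x : ℝ≥0 → ℝ) {s : ℝ≥0} (hs : s ≤ t) :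
    D.sqSum x s = D.incrSum (fun a b => (x b - x a) ^ 2) 0 s := by
  rw [incrSum_zero_eq, sqSum]
  symm
  apply Finset.sum_subset_zero_on_sdiff
  · intro i hi
    simp only [Finset.mem_filter, Finset.mem_range] at hi ⊢
    exact ⟨by omega, hi.2.le⟩
  · intro i hi
    simp only [Finset.mem_sdiff, Finset.mem_filter, Finset.mem_range, not_and, not_lt] at hi
    have : D.p i = s := by
      by_cases h : i < D.n
      · exact le_antisymm hi.1.2 (hi.2 h)
      · obtain rfl : i = D.n := by omega
        exact le_antisymm hi.1.2 (hs.trans_eq D.last.symm)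
    simp [this]
  · intro i hi
    simp only [Finset.mem_filter, Finset.mem_range] at hi
    rw [if_neg hi.2.ne]

theorem incrSum_congr {c c' : ℝ≥0 → ℝ≥0 → ℝ} {a b : ℝ≥0}
    (h : ∀ i < D.n, a ≤ D.p i → D.p i < b →
      c (D.p i) (D.p (i + 1)) = c' (D.p i) (D.p (i + 1))) :
    D.incrSum c a b = D.incrSum c' a b := by
  apply Finset.sum_congr rfl
  intro i hi
  simp only [Finset.mem_filter, Finset.mem_range] at hi
  exact h i hi.1 hi.2.1 hi.2.2

theorem incrSum_le {c c' : ℝ≥0 → ℝ≥0 → ℝ} {a b : ℝ≥0}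
    (h : ∀ i < D.n, a ≤ D.p i → D.p i < b →
      c (D.p i) (D.p (i + 1)) ≤ c' (D.p i) (D.p (i + 1))) :
    D.incrSum c a b ≤ D.incrSum c' a b := by
  apply Finset.sum_le_sum
  intro i hi
  simp only [Finset.mem_filter, Finset.mem_range] at hi
  exact h i hi.1 hi.2.1 hi.2.2

theorem incrSum_nonneg {c : ℝ≥0 → ℝ≥0 → ℝ} (hc : ∀ a b, 0 ≤ c a b) (a b : ℝ≥0) :
    0 ≤ D.incrSum c a b := Finset.sum_nonneg fun _ _ => hc _ _

theorem incrSum_split (c : ℝ≥0 → ℝ≥0 → ℝ) {a b d : ℝ≥0} (hab : a ≤ b) (hbd : b ≤ d) :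
    D.incrSum c a d = D.incrSum c a b + D.incrSum c b d := by
  unfold incrSum
  rw [← Finset.sum_union]
  · congr 1
    ext i
    simp only [Finset.mem_filter, Finset.mem_range, Finset.mem_union]
    constructor
    · rintro ⟨h1, h2, h3⟩
      rcases lt_or_ge (D.p i) b with h | h
      · exact Or.inl ⟨h1, h2, h⟩
      · exact Or.inr ⟨h1, h, h3⟩
    · rintro (⟨h1, h2, h3⟩ | ⟨h1, h2, h3⟩)
      · exact ⟨h1, h2, h3.trans_le hbd⟩
      · exact ⟨h1, hab.trans h2, h3⟩
  · rw [Finset.disjoint_left]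
    intro i hi hi'
    simp only [Finset.mem_filter] at hi hi'
    exact absurd hi.2.2 (not_lt.2 hi'.2.1)

theorem incrSum_mono {c : ℝ≥0 → ℝ≥0 → ℝ} (hc : ∀ a b, 0 ≤ c a b) {a a' b b' : ℝ≥0}
    (ha : a' ≤ a) (hb : b ≤ b') : D.incrSum c a b ≤ D.incrSum c a' b' := by
  apply Finset.sum_le_sum_of_subset_of_nonneg
  · intro i hi
    simp only [Finset.mem_filter, Finset.mem_range] at hi ⊢
    exact ⟨hi.1, ha.trans hi.2.1, hi.2.2.trans_le hb⟩
  · exact fun _ _ _ => hc _ _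

theorem incrSum_add (c c' : ℝ≥0 → ℝ≥0 → ℝ) (a b : ℝ≥0) :
    D.incrSum (fun u v => c u v + c' u v) a b = D.incrSum c a b + D.incrSum c' a b :=
  Finset.sum_add_distrib

theorem incrSum_sub (c c' : ℝ≥0 → ℝ≥0 → ℝ) (a b : ℝ≥0) :
    D.incrSum (fun u v => c u v - c' u v) a b = D.incrSum c a b - D.incrSum c' a b :=
  Finset.sum_sub_distrib _ _

theorem incrSum_const_mul (r : ℝ) (c : ℝ≥0 → ℝ≥0 → ℝ) (a b : ℝ≥0) :
    D.incrSum (fun u v => r * c u v) a b = r * D.incrSum c a b :=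
  (Finset.mul_sum _ _ _).symm

theorem abs_incrSum_sub_le {c c' m : ℝ≥0 → ℝ≥0 → ℝ} {ε : ℝ} {a b : ℝ≥0}
    (h : ∀ i < D.n, a ≤ D.p i → D.p i < b →
      |c (D.p i) (D.p (i + 1)) - c' (D.p i) (D.p (i + 1))| ≤ ε * m (D.p i) (D.p (i + 1))) :
    |D.incrSum c a b - D.incrSum c' a b| ≤ ε * D.incrSum m a b := by
  rw [← incrSum_sub, ← incrSum_const_mul]
  refine (Finset.abs_sum_le_sum_abs _ _).trans ?_
  apply Finset.sum_le_sum
  intro i hi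
  simp only [Finset.mem_filter, Finset.mem_range] at hi
  exact h i hi.1 hi.2.1 hi.2.2

theorem exists_index {u : ℝ≥0} (hu : 0 < u) (hut : u ≤ t) :
    ∃ i < D.n, D.p i < u ∧ u ≤ D.p (i + 1) := by
  have hex : ∃ j, u ≤ D.p j := ⟨D.n, D.last.symm ▸ hut⟩
  classical
  set j := Nat.find hex
  have hj : u ≤ D.p j := Nat.find_spec hex
  have hj0 : j ≠ 0 := by
    intro h
    rw [h, D.first] at hj
    exact absurd hu (not_lt.2 hj)
  have hjn : j ≤ D.n := Nat.find_min' hex (D.last.symm ▸ hut)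
  refine ⟨j - 1, by omega, ?_, ?_⟩
  · exact not_le.1 (Nat.find_min hex (show j - 1 < j by omega))
  · rwa [Nat.sub_add_cancel (by omega)]

open Classical in
/-- The index of the interval `(t_i, t_{i+1}]` that contains `u`. -/
noncomputable def idx (u : ℝ≥0) : ℕ :=
  -- The default `0` is taken only for `u` outside `(0, t]`.
  if h : ∃ i < D.n, D.p i < u ∧ u ≤ D.p (i + 1) then h.choose else 0

theorem idx_spec {u : ℝ≥0} (hu : 0 < u) (hut : u ≤ t) :
    D.idx u < D.n ∧ D.p (D.idx u) < u ∧ u ≤ D.p (D.idx u + 1) := by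
  rw [idx, dif_pos (D.exists_index hu hut)]
  exact (D.exists_index hu hut).choose_spec

/-- The left endpoint of the interval of the partition that contains `u`. -/
noncomputable def left (u : ℝ≥0) : ℝ≥0 := D.p (D.idx u)

/-- The right endpoint of the interval of the partition that contains `u`. -/
noncomputable def right (u : ℝ≥0) : ℝ≥0 := D.p (D.idx u + 1)

theorem left_le {u : ℝ≥0} (hu : 0 < u) (hut : u ≤ t) : D.left u ≤ t :=
  D.p_le (D.idx_spec hu hut).1.le

theorem right_le {u : ℝ≥0} (hu : 0 < u) (hut : u ≤ t) : D.right u ≤ t :=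
  D.p_le (D.idx_spec hu hut).1

theorem p_lt_iff {u : ℝ≥0} (hu : 0 < u) (hut : u ≤ t) {i : ℕ} (hi : i < D.n) :
    D.p i < u ↔ i ≤ D.idx u := by
  obtain ⟨h1, h2, h3⟩ := D.idx_spec hu hut
  constructor
  · intro h
    by_contra hlt
    exact absurd (h3.trans (D.p_mono (show D.idx u + 1 ≤ i by omega) hi.le)) (not_le.2 h)
  · intro h
    exact (D.p_mono h h1.le).trans_lt h2

/-- Splits off the interval that contains `s`, which may end after `s` and whose increment carries
the jump at `s`. By `p_succ_le_left` all earlier intervals end strictly before `s`. -/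
theorem incrSum_eq_add_last (c : ℝ≥0 → ℝ≥0 → ℝ) {r s : ℝ≥0} (hs : 0 < s) (hst : s ≤ t)
    (hr : r ≤ D.left s) :
    D.incrSum c r s = D.incrSum c r (D.left s) + c (D.left s) (D.right s) := by
  obtain ⟨h1, h2, h3⟩ := D.idx_spec hs hst
  rw [D.incrSum_split c hr h2.le]
  congr 1
  have : (Finset.range D.n).filter (fun i => D.left s ≤ D.p i ∧ D.p i < s) = {D.idx s} := by
    ext i
    rw [Finset.mem_filter, Finset.mem_range, Finset.mem_singleton]
    unfold left
    constructor
    · rintro ⟨hi, h4, h5⟩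
      have h6 := (D.p_lt_iff hs hst hi).1 h5
      by_contra hne
      exact absurd (D.p_strictMono (show i < D.idx s by omega) h1.le) (not_lt.2 h4)
    · rintro rfl
      exact ⟨h1, le_rfl, h2⟩
  rw [incrSum, this, Finset.sum_singleton]
  rfl

theorem p_succ_le_left {s : ℝ≥0} (hs : 0 < s) (hst : s ≤ t) {i : ℕ} (hi : i < D.n)
    (h : D.p i < D.left s) : D.p (i + 1) ≤ D.left s := by
  obtain ⟨h1, h2, h3⟩ := D.idx_spec hs hst
  have h4 := (D.p_lt_iff hs hst hi).1 (h.trans h2)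
  have h5 : i ≠ D.idx s := by
    rintro rfl
    exact absurd h (lt_irrefl _)
  exact D.p_mono (by omega) h1.le

section Limits

variable {ι : Type*} {l : Filter ι} {D : ι → TimePartition t}

/-- The approach is strictly from below, so a path evaluated at these points tends to its left
limit; with `tendsto_right` the increment over the interval around `u` tends to the jump at `u`. -/
theorem tendsto_left (hD : Tendsto (fun k => (D k).mesh) l (𝓝 0)) {u : ℝ≥0} (hu : 0 < u)
    (hut : u ≤ t) : Tendsto (fun k => (D k).left u) l (𝓝[<] u) := by
  refine tendsto_nhdsWithin_iff.2 ⟨?_, Eventually.of_forall fun k => ((D k).idx_spec hu hut).2.1⟩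
  have h1 : Tendsto (fun k => u - (D k).mesh) l (𝓝 u) := by
    simpa using (tendsto_const_nhds (x := u)).sub hD
  refine tendsto_of_tendsto_of_tendsto_of_le_of_le h1 tendsto_const_nhds (fun k => ?_)
    (fun k => ((D k).idx_spec hu hut).2.1.le)
  obtain ⟨h1, h2, h3⟩ := (D k).idx_spec hu hut
  exact tsub_le_iff_right.2 (h3.trans ((D k).p_succ_le h1))

theorem tendsto_right (hD : Tendsto (fun k => (D k).mesh) l (𝓝 0)) {u : ℝ≥0} (hu : 0 < u)
    (hut : u ≤ t) : Tendsto (fun k => (D k).right u) l (𝓝[≥] u) := by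
  refine tendsto_nhdsWithin_iff.2 ⟨?_, Eventually.of_forall fun k => ((D k).idx_spec hu hut).2.2⟩
  have h1 : Tendsto (fun k => u + (D k).mesh) l (𝓝 u) := by
    simpa using (tendsto_const_nhds (x := u)).add hD
  refine tendsto_of_tendsto_of_tendsto_of_le_of_le tendsto_const_nhds h1
    (fun k => ((D k).idx_spec hu hut).2.2) (fun k => ?_)
  obtain ⟨h1, h2, h3⟩ := (D k).idx_spec hu hut
  exact ((D k).p_succ_le h1).trans (by gcongr)

theorem eventually_p_succ_lt (hD : Tendsto (fun k => (D k).mesh) l (𝓝 0)) {s s₁ : ℝ≥0}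
    (h : s < s₁) : ∀ᶠ k in l, ∀ i < (D k).n, (D k).p i < s → (D k).p (i + 1) < s₁ := by
  have h1 : Tendsto (fun k => s + (D k).mesh) l (𝓝 s) := by
    simpa using (tendsto_const_nhds (x := s)).add hD
  filter_upwards [h1.eventually_lt_const h] with k hk i hi his
  exact ((D k).p_succ_le hi).trans_lt ((add_le_add his.le le_rfl).trans_lt hk)

/-- Fatou's lemma for jumps: the limit of sums over the partitions dominates the sum of the
limits at finitely many points. -/
theorem sum_jump_le_of_tendsto [l.NeBot] (hD : Tendsto (fun k => (D k).mesh) l (𝓝 0))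
    {c : ℝ≥0 → ℝ≥0 → ℝ} (hc : ∀ a b, a ≤ t → b ≤ t → 0 ≤ c a b) {r s : ℝ≥0} (hst : s ≤ t) {v : ℝ}
    (hv : Tendsto (fun k => (D k).incrSum c r s) l (𝓝 v)) (F : Finset ℝ≥0)
    (hF : ∀ u ∈ F, r < u ∧ u ≤ s) (cu : ℝ≥0 → ℝ)
    (hcu : ∀ u ∈ F, Tendsto (fun k => c ((D k).left u) ((D k).right u)) l (𝓝 (cu u))) :
    ∑ u ∈ F, cu u ≤ v := by
  have hpos : ∀ u ∈ F, 0 < u ∧ u ≤ t := fun u hu =>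
    ⟨zero_le.trans_lt (hF u hu).1, (hF u hu).2.trans hst⟩
  refine le_of_tendsto_of_tendsto (tendsto_finsetSum _ hcu) hv ?_
  -- For fine partitions the points of `F` lie in distinct intervals starting at or after `r`, so
  -- the finite sum is part of the full one and the omitted terms are nonnegative.
  have h1 : ∀ᶠ k in l, ∀ u ∈ F, r ≤ (D k).left u := by
    rw [Filter.eventually_all_finset]
    intro u hu
    have := tendsto_nhds_of_tendsto_nhdsWithin (tendsto_left hD (hpos u hu).1 (hpos u hu).2)
    filter_upwards [this.eventually_const_lt (hF u hu).1] with k hk using hk.le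
  have h2 : ∀ᶠ k in l, ∀ u ∈ F, ∀ u' ∈ F, u < u' → u ≤ (D k).left u' := by
    rw [Filter.eventually_all_finset]
    intro u hu
    rw [Filter.eventually_all_finset]
    intro u' hu'
    by_cases h : u < u'
    · have := tendsto_nhds_of_tendsto_nhdsWithin (tendsto_left hD (hpos u' hu').1 (hpos u' hu').2)
      filter_upwards [this.eventually_const_lt h] with k hk _ using hk.le
    · exact Eventually.of_forall fun k h' => absurd h' h
  filter_upwards [h1, h2] with k hk1 hk2
  have hlt : ∀ u ∈ F, ∀ u' ∈ F, u < u' → (D k).idx u ≠ (D k).idx u' := by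
    intro u hu u' hu' h heq
    have := ((D k).idx_spec (hpos u hu).1 (hpos u hu).2).2.1
    have h3 := hk2 u hu u' hu' h
    rw [left, ← heq] at h3
    exact absurd this (not_lt.2 h3)
  have hinj : Set.InjOn (D k).idx F := by
    intro u hu u' hu' heq
    rcases lt_trichotomy u u' with h | h | h
    · exact absurd heq (hlt u hu u' hu' h)
    · exact h
    · exact absurd heq.symm (hlt u' hu' u hu h)
  calc ∑ u ∈ F, c ((D k).left u) ((D k).right u)
      = ∑ i ∈ F.image (D k).idx, c ((D k).p i) ((D k).p (i + 1)) := by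
        rw [Finset.sum_image hinj]; rfl
    _ ≤ _ := by
        apply Finset.sum_le_sum_of_subset_of_nonneg
        · intro i hi
          obtain ⟨u, hu, rfl⟩ := Finset.mem_image.1 hi
          obtain ⟨h3, h4, h5⟩ := (D k).idx_spec (hpos u hu).1 (hpos u hu).2
          simp only [Finset.mem_filter, Finset.mem_range]
          exact ⟨h3, hk1 u hu, h4.trans_le (hF u hu).2⟩
        · intro i hi _
          simp only [Finset.mem_filter, Finset.mem_range] at hi
          exact hc _ _ ((D k).p_le hi.1.le) ((D k).p_le hi.1)

end Limits

end TimePartition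

/-! ### Cadlag paths -/

section Cadlag

variable {x y : ℝ≥0 → ℝ}

theorem IsCadlag.tendsto_leftLim (hx : IsCadlag x) (s : ℝ≥0) :
    Tendsto x (𝓝[<] s) (𝓝 (Function.leftLim x s)) :=
  tendsto_leftLim_of_tendsto (hx s).2

theorem IsCadlag.sub (hx : IsCadlag x) (hy : IsCadlag y) : IsCadlag (fun s => x s - y s) :=
  fun s => ⟨(hx s).1.sub (hy s).1, _, (hx.tendsto_leftLim s).sub (hy.tendsto_leftLim s)⟩

theorem IsCadlag.comp (hx : IsCadlag x) {f : ℝ → ℝ} (hf : Continuous f) :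
    IsCadlag (fun s => f (x s)) :=
  fun s => ⟨hf.continuousAt.comp_continuousWithinAt (hx s).1, _,
    (hf.tendsto _).comp (hx.tendsto_leftLim s)⟩

theorem leftLim_zero (x : ℝ≥0 → ℝ) : Function.leftLim x 0 = x 0 :=
  leftLim_eq_of_isBot isBot_bot

theorem jump_zero (x : ℝ≥0 → ℝ) : jump x 0 = 0 := by
  rw [jump, leftLim_zero, sub_self]

theorem nhdsLT_neBot_of_pos {s : ℝ≥0} (hs : 0 < s) : (𝓝[<] s).NeBot :=
  nhdsLT_neBot_of_exists_lt ⟨0, hs⟩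

theorem IsCadlag.leftLim_comp (hx : IsCadlag x) {f : ℝ → ℝ} (hf : Continuous f) (s : ℝ≥0) :
    Function.leftLim (fun r => f (x r)) s = f (Function.leftLim x s) := by
  rcases eq_or_ne s 0 with rfl | hs
  · simp only [leftLim_zero]
  · have := nhdsLT_neBot_of_pos (pos_iff_ne_zero.2 hs)
    exact leftLim_eq_of_tendsto ((hf.tendsto _).comp (hx.tendsto_leftLim s))

theorem IsCadlag.exists_right (hx : IsCadlag x) (s : ℝ≥0) {η : ℝ} (hη : 0 < η) :
    ∃ s₁ > s, ∀ a, s ≤ a → a < s₁ → |x a - x s| < η := by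
  have h := (Metric.tendsto_nhds.1 (hx s).1 η hη)
  obtain ⟨u, hu, h2⟩ := (mem_nhdsGE_iff_exists_Ico_subset (a := s)).1 h
  exact ⟨u, hu, fun a ha hau => h2 ⟨ha, hau⟩⟩

theorem IsCadlag.exists_left (hx : IsCadlag x) {s : ℝ≥0} (hs : 0 < s) {η : ℝ} (hη : 0 < η) :
    ∃ s₀ < s, ∀ a, s₀ < a → a < s → |x a - Function.leftLim x s| < η := by
  have h := (Metric.tendsto_nhds.1 (hx.tendsto_leftLim s) η hη)
  obtain ⟨u, hu, h2⟩ := (mem_nhdsLT_iff_exists_Ioo_subset' hs).1 h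
  exact ⟨u, hu, fun a ha hau => h2 ⟨ha, hau⟩⟩

theorem IsCadlag.exists_bound (hx : IsCadlag x) {t : ℝ≥0} (ht : 0 < t) :
    ∃ B, ∀ s ≤ t, |x s| ≤ B := by
  suffices h : ∃ B, ∀ s, 0 ≤ s → s ≤ t → |x s| ≤ B by
    obtain ⟨B, hB⟩ := h
    exact ⟨B, fun s hs => hB s zero_le hs⟩
  refine interval_induction (R := fun a b => ∃ B, ∀ s, a ≤ s → s ≤ b → |x s| ≤ B) ht ?_ ?_ ?_
  · rintro a b c - - ⟨B, hB⟩ ⟨B', hB'⟩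
    refine ⟨max B B', fun s h1 h2 => ?_⟩
    rcases le_total s b with h | h
    · exact (hB s h1 h).trans (le_max_left _ _)
    · exact (hB' s h h2).trans (le_max_right _ _)
  · intro s _ _
    obtain ⟨s₁, h, h1⟩ := hx.exists_right s one_pos
    refine ⟨s₁, h, fun r hsr hr _ => ⟨|x s| + 1, fun a ha har => ?_⟩⟩
    have := h1 a ha (har.trans_lt hr)
    have h3 := abs_sub_abs_le_abs_sub (x a) (x s)
    linarith
  · intro s hs _
    obtain ⟨s₀, h, h1⟩ := hx.exists_left hs one_pos
    refine ⟨s₀, h, fun r hsr hr _ => ⟨max (|Function.leftLim x s| + 1) |x s|, fun a ha has => ?_⟩⟩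
    rcases has.lt_or_eq with h2 | rfl
    · have := h1 a (hsr.trans_le ha) h2
      have h3 := abs_sub_abs_le_abs_sub (x a) (Function.leftLim x s)
      exact le_max_of_le_left (by linarith)
    · exact le_max_right _ _

/-- Where a path stays within `η` of a constant, so do its left limits; this bounds jumps near a
given time. -/
theorem IsCadlag.abs_leftLim_sub_le (hx : IsCadlag x) {s₀ s : ℝ≥0} {v η : ℝ}
    (h : ∀ a, s₀ < a → a < s → |x a - v| ≤ η) (hs : s₀ < s) :
    |Function.leftLim x s - v| ≤ η := by
  have := nhdsLT_neBot_of_pos (zero_le.trans_lt hs)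
  have h1 : Tendsto (fun a => |x a - v|) (𝓝[<] s) (𝓝 |Function.leftLim x s - v|) :=
    ((hx.tendsto_leftLim s).sub_const v).abs
  refine le_of_tendsto h1 ?_
  filter_upwards [Ioo_mem_nhdsLT hs] with a ha using h a ha.1 ha.2

theorem IsCadlag.abs_leftLim_le (hx : IsCadlag x) {t : ℝ≥0} {B : ℝ} (h : ∀ s ≤ t, |x s| ≤ B)
    {s : ℝ≥0} (hs : s ≤ t) : |Function.leftLim x s| ≤ B := by
  rcases eq_or_ne s 0 with rfl | h0
  · rw [leftLim_zero]; exact h 0 hs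
  · simpa using hx.abs_leftLim_sub_le (s₀ := 0) (s := s) (v := 0) (η := B)
      (fun a _ ha => by simpa using h a (ha.le.trans hs)) (pos_iff_ne_zero.2 h0)

/-- Left limits of a cadlag path form a Borel function. -/
theorem IsCadlag.measurable_leftLim (hx : IsCadlag x) : Measurable (Function.leftLim x) := by
  -- For `u > 0` this is the last point strictly before `u` on the grid of step `1 / (k + 1)`.
  -- Natural subtraction makes it `0` at `u = 0`, in accordance with the left limit there.
  let a : ℕ → ℝ≥0 → ℝ≥0 := fun k u => ((⌈u * (k + 1)⌉₊ - 1 : ℕ) : ℝ≥0) / (k + 1)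
  have ha : ∀ u, 0 < u → Tendsto (fun k => a k u) atTop (𝓝[<] u) := by
    intro u hu
    have hlt : ∀ k, a k u < u := by
      intro k
      have hk : (0 : ℝ≥0) < k + 1 := by positivity
      rw [div_lt_iff₀ hk]
      have : ⌈u * (k + 1)⌉₊ - 1 < ⌈u * (k + 1)⌉₊ :=
        Nat.sub_lt (Nat.ceil_pos.2 (mul_pos hu hk)) one_pos
      exact Nat.lt_ceil.1 this
    have hle : ∀ k, u - 1 / (k + 1) ≤ a k u := by
      intro k
      have hk : (0 : ℝ≥0) < k + 1 := by positivity
      rw [tsub_le_iff_right, ← add_div, le_div_iff₀ hk]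
      refine (Nat.le_ceil _).trans ?_
      have : 1 ≤ ⌈u * (k + 1)⌉₊ := Nat.ceil_pos.2 (mul_pos hu hk)
      exact_mod_cast (Nat.sub_add_cancel this).ge
    refine tendsto_nhdsWithin_iff.2 ⟨?_, Eventually.of_forall hlt⟩
    have h1 : Tendsto (fun k : ℕ => u - 1 / ((k : ℝ≥0) + 1)) atTop (𝓝 u) := by
      simpa using (tendsto_const_nhds (x := u)).sub
        (tendsto_one_div_add_atTop_nhds_zero_nat (𝕜 := ℝ≥0))
    exact tendsto_of_tendsto_of_tendsto_of_le_of_le h1 tendsto_const_nhds hle fun k => (hlt k).le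
  refine measurable_of_tendsto_metrizable (f := fun k u => x (a k u)) (fun k => ?_) ?_
  · exact (measurable_from_nat (f := fun j => x (((j - 1 : ℕ) : ℝ≥0) / (k + 1)))).comp
      (Nat.measurable_ceil.comp (measurable_id.mul_const _))
  · rw [tendsto_pi_nhds]
    intro u
    rcases eq_or_ne u 0 with rfl | hu
    · simp [a, leftLim_zero]
    · exact (hx.tendsto_leftLim u).comp (ha u (pos_iff_ne_zero.2 hu))

section Partition

variable {t : ℝ≥0} {ι : Type*} {l : Filter ι} {D : ι → TimePartition t}

theorem IsCadlag.tendsto_left (hx : IsCadlag x) (hD : Tendsto (fun k => (D k).mesh) l (𝓝 0))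
    {u : ℝ≥0} (hu : 0 < u) (hut : u ≤ t) :
    Tendsto (fun k => x ((D k).left u)) l (𝓝 (Function.leftLim x u)) :=
  (hx.tendsto_leftLim u).comp (TimePartition.tendsto_left hD hu hut)

theorem IsCadlag.tendsto_right (hx : IsCadlag x) (hD : Tendsto (fun k => (D k).mesh) l (𝓝 0))
    {u : ℝ≥0} (hu : 0 < u) (hut : u ≤ t) :
    Tendsto (fun k => x ((D k).right u)) l (𝓝 (x u)) :=
  (hx u).1.tendsto.comp (TimePartition.tendsto_right hD hu hut)

theorem IsCadlag.tendsto_jump (hx : IsCadlag x) (hD : Tendsto (fun k => (D k).mesh) l (𝓝 0))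
    {u : ℝ≥0} (hu : 0 < u) (hut : u ≤ t) :
    Tendsto (fun k => x ((D k).right u) - x ((D k).left u)) l (𝓝 (jump x u)) :=
  (hx.tendsto_right hD hu hut).sub (hx.tendsto_left hD hu hut)

end Partition

end Cadlag

/-! ### Sums of jumps as functions of time -/

section JumpSum

variable {j : ℝ≥0 → ℝ} {t : ℝ≥0}

theorem summable_indicator_Icc (hj : Summable ((Set.Icc 0 t).indicator j)) {A : Set ℝ≥0}
    (hA : A ⊆ Set.Icc 0 t) : Summable (A.indicator j) := by
  have := hj.indicator A
  rwa [Set.indicator_indicator, Set.inter_eq_self_of_subset_left hA] at this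

/-- Dominated convergence: the indicators of `[0, r]` tend to that of `[0, s]` as `r ↓ s`. As `r ↑
s` they tend to that of `[0, s)`, hence the loss of `j s` in `tendsto_tsum_indicator_left`. -/
theorem tendsto_tsum_indicator_right (hj : Summable ((Set.Icc 0 t).indicator j)) {s : ℝ≥0}
    (hs : s < t) :
    Tendsto (fun r => ∑' u, (Set.Icc 0 r).indicator j u) (𝓝[>] s)
      (𝓝 (∑' u, (Set.Icc 0 s).indicator j u)) := by
  refine tendsto_tsum_of_dominated_convergence (hj.norm) (fun u => ?_) ?_
  · refine Tendsto.congr' ?_ tendsto_const_nhds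
    rcases le_or_gt u s with h | h
    · filter_upwards [self_mem_nhdsWithin] with r hr
      rw [Set.indicator_of_mem (by exact ⟨zero_le, h⟩), Set.indicator_of_mem]
      exact ⟨zero_le, h.trans (le_of_lt hr)⟩
    · filter_upwards [Ioo_mem_nhdsGT h] with r hr
      rw [Set.indicator_of_notMem (fun h' => absurd h'.2 (not_le.2 h)), Set.indicator_of_notMem]
      exact fun h' => absurd h'.2 (not_le.2 hr.2)
  · filter_upwards [Ioo_mem_nhdsGT hs] with r hr u
    by_cases h : u ∈ Set.Icc 0 r
    · rw [Set.indicator_of_mem h, Set.indicator_of_mem (by exact ⟨h.1, h.2.trans hr.2.le⟩)]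
    · rw [Set.indicator_of_notMem h]; simp

theorem tsum_indicator_Icc_sub (hj : Summable ((Set.Icc 0 t).indicator j)) {s : ℝ≥0}
    (hs : s ≤ t) :
    (∑' u, (Set.Icc 0 s).indicator j u) - j s = ∑' u, (Set.Ico 0 s).indicator j u := by
  have h1 : Summable ((Set.Ico 0 s).indicator j) :=
    summable_indicator_Icc hj (Set.Ico_subset_Icc_self.trans (Set.Icc_subset_Icc_right hs))
  have h2 := h1.hasSum.add (hasSum_ite_eq s (j s))
  have h3 : (fun u => (Set.Ico 0 s).indicator j u + if u = s then j s else 0) =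
      (Set.Icc 0 s).indicator j := by
    funext u
    rcases lt_trichotomy u s with h | h | h
    · simp [Set.indicator, h, h.le, h.ne]
    · simp [Set.indicator, h]
    · simp [Set.indicator, h.not_ge, h.le, h.ne']
  rw [h3] at h2
  rw [h2.tsum_eq]
  ring

theorem tendsto_tsum_indicator_left (hj : Summable ((Set.Icc 0 t).indicator j)) {s : ℝ≥0}
    (hs : s ≤ t) :
    Tendsto (fun r => ∑' u, (Set.Icc 0 r).indicator j u) (𝓝[<] s)
      (𝓝 ((∑' u, (Set.Icc 0 s).indicator j u) - j s)) := by
  rw [tsum_indicator_Icc_sub hj hs]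
  refine tendsto_tsum_of_dominated_convergence (hj.norm) (fun u => ?_) ?_
  · refine Tendsto.congr' ?_ tendsto_const_nhds
    rcases lt_or_ge u s with h | h
    · filter_upwards [Ioo_mem_nhdsLT h] with r hr
      rw [Set.indicator_of_mem (by exact ⟨zero_le, h⟩), Set.indicator_of_mem]
      exact ⟨zero_le, hr.1.le⟩
    · filter_upwards [self_mem_nhdsWithin] with r hr
      rw [Set.indicator_of_notMem (fun h' => absurd h'.2 (not_lt.2 h)), Set.indicator_of_notMem]
      exact fun h' => absurd (h.trans h'.2) (not_le.2 hr)
  · filter_upwards [self_mem_nhdsWithin] with r hr u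
    by_cases h : u ∈ Set.Icc 0 r
    · rw [Set.indicator_of_mem h,
        Set.indicator_of_mem (by exact ⟨h.1, h.2.trans ((le_of_lt hr).trans hs)⟩)]
    · rw [Set.indicator_of_notMem h]; simp

end JumpSum

/-! ### Pathwise quadratic variation -/

/-- The squared increments of a path. -/
def sqIncr (x : ℝ≥0 → ℝ) (a b : ℝ≥0) : ℝ := (x b - x a) ^ 2

theorem sqIncr_nonneg (x : ℝ≥0 → ℝ) (a b : ℝ≥0) : 0 ≤ sqIncr x a b := sq_nonneg _

/-- The sum of the squared jumps of a path up to time `s`. -/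
noncomputable def jumpSum (x : ℝ≥0 → ℝ) (s : ℝ≥0) : ℝ :=
  ∑' u, (Set.Icc 0 s).indicator (fun u => jump x u ^ 2) u

theorem jumpSum_zero (x : ℝ≥0 → ℝ) : jumpSum x 0 = 0 := by
  have : (Set.Icc (0 : ℝ≥0) 0).indicator (fun u => jump x u ^ 2) = 0 := by
    funext u
    by_cases h : u = 0
    · simp [h, jump_zero]
    · simp [h]
  rw [jumpSum, this]
  simp

/-- A path `q` that is continuous and increasing on `[0, t]` apart from the jumps, which are those
of the sum of the squared jumps of `x`. -/
structure IsJumpDecomp (t : ℝ≥0) (x q qc : ℝ≥0 → ℝ) : Prop where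
  cont : ContinuousOn qc (Set.Icc 0 t)
  mono : MonotoneOn qc (Set.Icc 0 t)
  hasSum : ∀ s ∈ Set.Ioc 0 t, HasSum (fun u : Set.Icc 0 s => jump x u ^ 2) (q s - qc s)

namespace IsJumpDecomp

variable {t : ℝ≥0} {x q qc : ℝ≥0 → ℝ}

theorem hasSum_indicator (h : IsJumpDecomp t x q qc) {s : ℝ≥0} (hs : s ∈ Set.Ioc 0 t) :
    HasSum ((Set.Icc 0 s).indicator fun u => jump x u ^ 2) (q s - qc s) :=
  hasSum_subtype_iff_indicator.1 (h.hasSum s hs)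

theorem summable (h : IsJumpDecomp t x q qc) (ht : 0 < t) :
    Summable ((Set.Icc 0 t).indicator fun u => jump x u ^ 2) :=
  (h.hasSum_indicator ⟨ht, le_rfl⟩).summable

theorem eq_add (h : IsJumpDecomp t x q qc) {s : ℝ≥0} (hs : s ∈ Set.Ioc 0 t) :
    q s = qc s + jumpSum x s := by
  rw [jumpSum, (h.hasSum_indicator hs).tsum_eq]
  ring

/-- Stated with `qc s + jumpSum x s` instead of `q s` so as to include `s = 0`, where `q` is
unconstrained. -/
theorem tendsto_right (h : IsJumpDecomp t x q qc) {s : ℝ≥0} (hs : s < t) :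
    Tendsto q (𝓝[>] s) (𝓝 (qc s + jumpSum x s)) := by
  have h1 : Tendsto qc (𝓝[>] s) (𝓝 (qc s)) := by
    have := h.cont s ⟨zero_le, hs.le⟩
    refine this.tendsto.mono_left (nhdsWithin_le_iff.2 ?_)
    filter_upwards [Ioo_mem_nhdsGT hs] with r hr using ⟨zero_le, hr.2.le⟩
  refine (h1.add (tendsto_tsum_indicator_right (h.summable (zero_le.trans_lt hs)) hs)).congr' ?_
  filter_upwards [Ioo_mem_nhdsGT hs] with r hr
  exact (h.eq_add ⟨zero_le.trans_lt hr.1, hr.2.le⟩).symm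

theorem tendsto_left (h : IsJumpDecomp t x q qc) {s : ℝ≥0} (hs : s ∈ Set.Ioc 0 t) :
    Tendsto q (𝓝[<] s) (𝓝 (q s - jump x s ^ 2)) := by
  have h1 : Tendsto qc (𝓝[<] s) (𝓝 (qc s)) := by
    have := h.cont s ⟨zero_le, hs.2⟩
    refine this.tendsto.mono_left (nhdsWithin_le_iff.2 ?_)
    filter_upwards [self_mem_nhdsWithin] with r hr
    exact ⟨zero_le, (le_of_lt hr).trans hs.2⟩
  have h2 := tendsto_tsum_indicator_left (h.summable (hs.1.trans_le hs.2)) hs.2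
  rw [h.eq_add hs, add_sub_assoc]
  refine (h1.add h2).congr' ?_
  filter_upwards [Ioo_mem_nhdsLT hs.1] with r hr
  exact (h.eq_add ⟨hr.1, hr.2.le.trans hs.2⟩).symm

end IsJumpDecomp

/-- The pathwise quadratic variation of `x` along the partitions `D k`, as `k` tends to `l`. -/
structure IsPathQuadVar {t : ℝ≥0} {ι : Type*} (l : Filter ι) (D : ι → TimePartition t)
    (x q qc : ℝ≥0 → ℝ) : Prop extends IsJumpDecomp t x q qc where
  tendsto : ∀ s ∈ Set.Ioc 0 t, Tendsto (fun k => (D k).incrSum (sqIncr x) 0 s) l (𝓝 (q s))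

section Pathwise

variable {t : ℝ≥0} {ι : Type*} {l : Filter ι} {D : ι → TimePartition t} {x y q qc : ℝ≥0 → ℝ}

theorem IsCadlag.tendsto_sqIncr (hx : IsCadlag x) (hD : Tendsto (fun k => (D k).mesh) l (𝓝 0))
    {u : ℝ≥0} (hu : 0 < u) (hut : u ≤ t) :
    Tendsto (fun k => sqIncr x ((D k).left u) ((D k).right u)) l (𝓝 (jump x u ^ 2)) :=
  (hx.tendsto_jump hD hu hut).pow 2

/-- Convergence of the sums of squared increments on a dense set of times implies convergence at
all times. -/
theorem IsJumpDecomp.isPathQuadVar (h : IsJumpDecomp t x q qc) (hx : IsCadlag x)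
    (hD : Tendsto (fun k => (D k).mesh) l (𝓝 0)) {S : Set ℝ≥0} (hS : t ∈ S)
    (hdense : ∀ a b, a < b → b ≤ t → ∃ r ∈ S, a < r ∧ r < b)
    (htend : ∀ s ∈ S, s ∈ Set.Ioc 0 t →
      Tendsto (fun k => (D k).incrSum (sqIncr x) 0 s) l (𝓝 (q s))) :
    IsPathQuadVar l D x q qc := by
  refine ⟨h, fun s hs => ?_⟩
  rcases hs.2.eq_or_lt with rfl | hst
  · exact htend s hS hs
  refine tendsto_order.2 ⟨fun a ha => ?_, fun a ha => ?_⟩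
  -- Lower bound: for `r ∈ S` just before `s`, `q r` misses only the squared jump at `s`, which the
  -- interval around `s` supplies in the limit.
  · have h1 : ∀ᶠ r in 𝓝[<] s, a - jump x s ^ 2 < q r :=
      (h.tendsto_left hs).eventually_const_lt (by linarith)
    obtain ⟨s₀, hs₀, h2⟩ := (mem_nhdsLT_iff_exists_Ioo_subset' hs.1).1 h1
    obtain ⟨r, hrS, hr1, hr2⟩ := hdense s₀ s hs₀ hs.2
    have h3 : a - jump x s ^ 2 < q r := h2 ⟨hr1, hr2⟩
    have h4 := (htend r hrS ⟨zero_le.trans_lt hr1, hr2.le.trans hs.2⟩).add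
      (hx.tendsto_sqIncr hD hs.1 hs.2)
    have h5 := tendsto_nhds_of_tendsto_nhdsWithin (TimePartition.tendsto_left hD hs.1 hs.2)
    filter_upwards [h4.eventually_const_lt (show a < _ by linarith), h5.eventually_const_lt hr2]
      with k hk hk2
    refine hk.trans_le ?_
    rw [(D k).incrSum_split _ zero_le hr2.le, (D k).incrSum_eq_add_last _ hs.1 hs.2 hk2.le]
    have := (D k).incrSum_nonneg (sqIncr_nonneg x) r ((D k).left s)
    linarith
  -- Upper bound: the sums increase in time and `q` is right-continuous at `s`.
  · have h1 : ∀ᶠ r in 𝓝[>] s, q r < a := by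
      have := h.tendsto_right hst
      rw [← h.eq_add hs] at this
      exact this.eventually_lt_const ha
    obtain ⟨s₁, hs₁, h2⟩ := (mem_nhdsGT_iff_exists_Ioo_subset' hst).1 h1
    obtain ⟨r, hrS, hr1, hr2⟩ := hdense s (min s₁ t) (lt_min hs₁ hst) (min_le_right _ _)
    have h3 : q r < a := h2 ⟨hr1, hr2.trans_le (min_le_left _ _)⟩
    filter_upwards [(htend r hrS ⟨hs.1.trans hr1, (hr2.trans_le (min_le_right _ _)).le⟩
      ).eventually_lt_const h3] with k hk
    exact ((D k).incrSum_mono (sqIncr_nonneg x) le_rfl hr1.le).trans_lt hk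

/-- Convergence at the end points of an interval gives convergence on the interval. -/
theorem exists_tendsto_incrSum_Ico {c : ℝ≥0 → ℝ≥0 → ℝ}
    (h : ∀ s ∈ Set.Ioc 0 t, ∃ v, Tendsto (fun k => (D k).incrSum c 0 s) l (𝓝 v)) {a b : ℝ≥0}
    (hab : a < b) (hb : b ≤ t) : ∃ v, Tendsto (fun k => (D k).incrSum c a b) l (𝓝 v) := by
  obtain ⟨v, hv⟩ := h b ⟨zero_le.trans_lt hab, hb⟩
  rcases eq_or_ne a 0 with rfl | ha
  · exact ⟨v, hv⟩
  · obtain ⟨w, hw⟩ := h a ⟨pos_iff_ne_zero.2 ha, hab.le.trans hb⟩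
    refine ⟨v - w, (hv.sub hw).congr fun k => ?_⟩
    rw [(D k).incrSum_split c zero_le hab.le]
    ring

/-- Sums over partitions converge if, locally on either side of each point, their terms are close
to the terms of convergent sums. -/
theorem exists_tendsto_incrSum [l.NeBot] (hD : Tendsto (fun k => (D k).mesh) l (𝓝 0))
    {c m : ℝ≥0 → ℝ≥0 → ℝ} (hm : ∀ a b, 0 ≤ m a b) {T : ℝ≥0} (hT : 0 < T) (hTt : T ≤ t) {M : ℝ}
    (hM : Tendsto (fun k => (D k).incrSum m 0 T) l (𝓝 M))
    (hright : ∀ s < T, ∀ ε > 0, ∃ ℓ : ℝ≥0 → ℝ≥0 → ℝ,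
      (∀ a b, a < b → b ≤ T → ∃ L, Tendsto (fun k => (D k).incrSum ℓ a b) l (𝓝 L)) ∧
      ∃ s₁ > s, ∀ a b, s ≤ a → a < b → b < s₁ → |c a b - ℓ a b| ≤ ε * m a b)
    (hleft : ∀ s, 0 < s → s ≤ T → ∀ ε > 0, ∃ ℓ : ℝ≥0 → ℝ≥0 → ℝ,
      (∀ a b, a < b → b ≤ T → ∃ L, Tendsto (fun k => (D k).incrSum ℓ a b) l (𝓝 L)) ∧
      (∃ L, Tendsto (fun k => ℓ ((D k).left s) ((D k).right s)) l (𝓝 L)) ∧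
      (∃ L, Tendsto (fun k => c ((D k).left s) ((D k).right s)) l (𝓝 L)) ∧
      ∃ s₀ < s, ∀ a b, s₀ < a → a < b → b < s → |c a b - ℓ a b| ≤ ε * m a b) :
    ∃ v, Tendsto (fun k => (D k).incrSum c 0 T) l (𝓝 v) := by
  -- The error bound must be additive over adjacent intervals. The length term provides strictly
  -- positive room for the convergence error of the sums of `ℓ`.
  have key : ∀ ε > 0, ∃ L, ∀ᶠ k in l,
      |(D k).incrSum c 0 T - L| ≤ ε * ((D k).incrSum m 0 T + ((T : ℝ) - (0 : ℝ≥0))) := by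
    intro ε hε
    refine interval_induction (R := fun a b => ∃ L, ∀ᶠ k in l,
      |(D k).incrSum c a b - L| ≤ ε * ((D k).incrSum m a b + ((b : ℝ) - a))) hT ?_ ?_ ?_
    · rintro a b d hab hbd ⟨L, hL⟩ ⟨L', hL'⟩
      refine ⟨L + L', ?_⟩
      filter_upwards [hL, hL'] with k hk hk'
      rw [(D k).incrSum_split c hab.le hbd.le, (D k).incrSum_split m hab.le hbd.le]
      rw [abs_le] at *
      constructor <;> linarith
    · intro s _ hs
      obtain ⟨ℓ, hℓ, s₁, hs₁, h1⟩ := hright s hs ε hε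
      refine ⟨s₁, hs₁, fun r hsr hr hrT => ?_⟩
      obtain ⟨L, hL⟩ := hℓ s r hsr hrT
      refine ⟨L, ?_⟩
      have hpos : 0 < ε * ((r : ℝ) - s) := mul_pos hε (sub_pos.2 (by exact_mod_cast hsr))
      filter_upwards [Metric.tendsto_nhds.1 hL _ hpos, TimePartition.eventually_p_succ_lt hD hr]
        with k hk hk2
      have h3 := (D k).abs_incrSum_sub_le (c := c) (c' := ℓ) (m := m) (ε := ε) (a := s) (b := r)
        fun i hi hi1 hi2 => h1 _ _ hi1 ((D k).lt_succ i hi) (hk2 i hi hi2)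
      rw [Real.dist_eq] at hk
      have := abs_sub_le ((D k).incrSum c s r) ((D k).incrSum ℓ s r) L
      linarith
    · intro s hs hsT
      obtain ⟨ℓ, hℓ, ⟨L₁, hL₁⟩, ⟨L₂, hL₂⟩, s₀, hs₀, h1⟩ := hleft s hs hsT ε hε
      refine ⟨s₀, hs₀, fun r hsr hr _ => ?_⟩
      obtain ⟨L, hL⟩ := hℓ r s hr hsT
      -- Across `s` itself `c` need not be close to `ℓ`: the limit `L₁` of the last term of `ℓ` is
      -- replaced by the limit `L₂` of that of `c`.
      refine ⟨L - L₁ + L₂, ?_⟩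
      have hpos : 0 < ε * ((s : ℝ) - r) := mul_pos hε (sub_pos.2 (by exact_mod_cast hr))
      have h5 := tendsto_nhds_of_tendsto_nhdsWithin
        (TimePartition.tendsto_left hD hs (hsT.trans hTt))
      filter_upwards [Metric.tendsto_nhds.1 ((hL.sub hL₁).add hL₂) _ hpos,
        h5.eventually_const_lt hr] with k hk hk2
      have h3 := (D k).abs_incrSum_sub_le (c := c) (c' := ℓ) (m := m) (ε := ε) (a := r)
        (b := (D k).left s) fun i hi hi1 hi2 => h1 _ _ (hsr.trans_le hi1) ((D k).lt_succ i hi)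
          (((D k).p_succ_le_left hs (hsT.trans hTt) hi hi2).trans_lt
            ((D k).idx_spec hs (hsT.trans hTt)).2.1)
      rw [Real.dist_eq, (D k).incrSum_eq_add_last ℓ hs (hsT.trans hTt) hk2.le] at hk
      have hmm := (D k).incrSum_eq_add_last m hs (hsT.trans hTt) hk2.le
      have hm0 := mul_nonneg hε.le (hm ((D k).left s) ((D k).right s))
      rw [(D k).incrSum_eq_add_last c hs (hsT.trans hTt) hk2.le, hmm]
      rw [abs_le] at h3 ⊢
      rw [abs_lt] at hk
      constructor <;> linarith
  have hcauchy : Cauchy (map (fun k => (D k).incrSum c 0 T) l) := by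
    refine Metric.cauchy_iff.2 ⟨inferInstance, fun ε hε => ?_⟩
    have hM0 : 0 ≤ M := ge_of_tendsto' hM fun k => (D k).incrSum_nonneg hm _ _
    have hKpos : 0 < M + 1 + T := by positivity
    obtain ⟨L, hL⟩ := key (ε / (3 * (M + 1 + T))) (by positivity)
    have hev : ∀ᶠ k in l, |(D k).incrSum c 0 T - L| ≤ ε / 3 := by
      filter_upwards [hL, hM.eventually_lt_const (lt_add_one M)] with k hk hk2
      refine hk.trans ?_
      calc _ ≤ ε / (3 * (M + 1 + T)) * (M + 1 + T) := by
            have h0 : (T : ℝ) - (0 : ℝ≥0) = T := by simp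
            rw [h0]
            gcongr
        _ = ε / 3 := by field_simp
    refine ⟨_, image_mem_map hev, ?_⟩
    rintro _ ⟨k, hk, rfl⟩ _ ⟨k', hk', rfl⟩
    have h1 : |(D k).incrSum c 0 T - L| ≤ ε / 3 := hk
    have h2 : |(D k').incrSum c 0 T - L| ≤ ε / 3 := hk'
    rw [Real.dist_eq]
    rw [abs_le] at h1 h2
    rw [abs_lt]
    constructor <;> linarith
  exact CompleteSpace.complete hcauchy

/-- Sums of functions of the increments that ignore small increments converge to the sum over the
jumps. -/
theorem IsCadlag.tendsto_incrSum_jump (hx : IsCadlag x)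
    (hD : Tendsto (fun k => (D k).mesh) l (𝓝 0)) {φ : ℝ → ℝ} (hφ : Continuous φ) {ε : ℝ}
    (hε : 0 < ε) (hφε : ∀ h, |h| ≤ ε → φ h = 0)
    (hsum : Summable ((Set.Icc 0 t).indicator fun u => φ (jump x u))) {s : ℝ≥0}
    (hs : s ∈ Set.Ioc 0 t) :
    Tendsto (fun k => (D k).incrSum (fun a b => φ (x b - x a)) 0 s) l
      (𝓝 (∑' u, (Set.Ioc 0 s).indicator (fun u => φ (jump x u)) u)) := by
  have key : s ≤ t → Tendsto (fun k => (D k).incrSum (fun a b => φ (x b - x a)) 0 s) l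
      (𝓝 (∑' u, (Set.Ioc 0 s).indicator (fun u => φ (jump x u)) u)) := by
    refine interval_induction (R := fun a b => b ≤ t →
      Tendsto (fun k => (D k).incrSum (fun a b => φ (x b - x a)) a b) l
        (𝓝 (∑' u, (Set.Ioc a b).indicator (fun u => φ (jump x u)) u))) hs.1 ?_ ?_ ?_
    · intro a b d hab hbd h1 h2 hdt
      have hsub : ∀ a b : ℝ≥0, b ≤ t → Summable ((Set.Ioc a b).indicator fun u => φ (jump x u)) :=
        fun a b hb => summable_indicator_Icc hsum fun u hu => ⟨zero_le, hu.2.trans hb⟩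
      have h3 := (h1 (hbd.le.trans hdt)).add (h2 hdt)
      rw [← (hsub a b (hbd.le.trans hdt)).tsum_add (hsub b d hdt)] at h3
      have h4 : (fun u => (Set.Ioc a b).indicator (fun u => φ (jump x u)) u +
          (Set.Ioc b d).indicator (fun u => φ (jump x u)) u) =
          (Set.Ioc a d).indicator fun u => φ (jump x u) := by
        rw [← Set.Ioc_union_Ioc_eq_Ioc hab.le hbd.le,
          Set.indicator_union_of_disjoint (Set.Ioc_disjoint_Ioc_of_le le_rfl)]
      rw [h4] at h3
      refine h3.congr fun k => ((D k).incrSum_split _ hab.le hbd.le).symm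
    · intro r _ _
      -- Staying within `ε / 2` of `x r`, all increments and jumps here are at most `ε`, so `φ`
      -- kills them.
      obtain ⟨s₁, hs₁, h1⟩ := hx.exists_right r (half_pos hε)
      refine ⟨s₁, hs₁, fun b hrb hb _ _ => ?_⟩
      have h2 : (Set.Ioc r b).indicator (fun u => φ (jump x u)) = 0 := by
        funext u
        by_cases hu : u ∈ Set.Ioc r b
        · rw [Set.indicator_of_mem hu]
          refine hφε _ ?_
          have h3 := hx.abs_leftLim_sub_le (v := x r) (η := ε / 2)
            (fun a ha1 ha2 => (h1 a ha1.le (ha2.trans_le (hu.2.trans hb.le))).le) hu.1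
          have h4 := h1 u hu.1.le (hu.2.trans_lt hb)
          rw [jump, abs_le]
          rw [abs_le] at h3
          rw [abs_lt] at h4
          constructor <;> linarith
        · rw [Set.indicator_of_notMem hu]; rfl
      rw [h2]
      refine Tendsto.congr' ?_ (by simpa using tendsto_const_nhds)
      filter_upwards [TimePartition.eventually_p_succ_lt hD hb] with k hk
      refine (Finset.sum_eq_zero fun i hi => ?_).symm
      simp only [Finset.mem_filter, Finset.mem_range] at hi
      refine hφε _ ?_
      have h3 := h1 _ hi.2.1 (hi.2.2.trans hb)
      have h4 := h1 _ (hi.2.1.trans ((D k).lt_succ i hi.1).le) (hk i hi.1 hi.2.2)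
      rw [abs_lt] at h3 h4
      rw [abs_le]
      constructor <;> linarith
    · intro b hb _
      obtain ⟨s₀, hs₀, h1⟩ := hx.exists_left hb (half_pos hε)
      refine ⟨s₀, hs₀, fun r hr hrb _ hbt => ?_⟩
      have h2 : ∀ u, u ≠ b → (Set.Ioc r b).indicator (fun u => φ (jump x u)) u = 0 := by
        intro u hub
        by_cases hu : u ∈ Set.Ioc r b
        · rw [Set.indicator_of_mem hu]
          refine hφε _ ?_
          have hlt := lt_of_le_of_ne hu.2 hub
          have h3 := hx.abs_leftLim_sub_le (v := Function.leftLim x b) (η := ε / 2)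
            (fun a ha1 ha2 => (h1 a (hr.trans ha1) (ha2.trans hlt)).le) hu.1
          have h4 := h1 u (hr.trans hu.1) hlt
          rw [jump, abs_le]
          rw [abs_le] at h3
          rw [abs_lt] at h4
          constructor <;> linarith
        · rw [Set.indicator_of_notMem hu]
      -- To the left of `b` only the jump at `b` and the increment across `b` survive.
      rw [tsum_eq_single b h2, Set.indicator_of_mem (by exact ⟨hrb, le_rfl⟩)]
      have h5 := tendsto_nhds_of_tendsto_nhdsWithin (TimePartition.tendsto_left hD hb hbt)
      refine Tendsto.congr' ?_ ((hφ.tendsto _).comp (hx.tendsto_jump hD hb hbt))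
      filter_upwards [h5.eventually_const_lt hrb] with k hk
      rw [(D k).incrSum_eq_add_last _ hb hbt hk.le, eq_comm]
      refine add_eq_right.2 (Finset.sum_eq_zero fun i hi => ?_)
      simp only [Finset.mem_filter, Finset.mem_range] at hi
      refine hφε _ ?_
      have hb' := ((D k).idx_spec hb hbt).2.1
      have h3 := h1 _ (hr.trans_le hi.2.1) (hi.2.2.trans hb')
      have h4 := h1 _ ((hr.trans_le hi.2.1).trans ((D k).lt_succ i hi.1))
        (((D k).p_succ_le_left hb hbt hi.1 hi.2.2).trans_lt hb')
      rw [abs_lt] at h3 h4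
      rw [abs_le]
      constructor <;> linarith
  exact key hs.2

end Pathwise

/-! ### Linearization and convergence of the sums for `f y - f x` -/

/-- Near a pair of points, the squared increments of `f y - f x` are those of its linearization up
to a small multiple of the squared increments of `x` and `y`. -/
theorem exists_abs_sq_sub_sq_le {f : ℝ → ℝ} (hf : ContDiff ℝ 1 f) (y₀ x₀ : ℝ) {ε : ℝ}
    (hε : 0 < ε) : ∃ ρ > 0, ∀ y₁ y₂ x₁ x₂, |y₁ - y₀| < ρ → |y₂ - y₀| < ρ → |x₁ - x₀| < ρ →
      |x₂ - x₀| < ρ → |((f y₂ - f x₂) - (f y₁ - f x₁)) ^ 2 -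
        (deriv f y₀ * (y₂ - y₁) - deriv f x₀ * (x₂ - x₁)) ^ 2| ≤
          ε * ((x₂ - x₁) ^ 2 + (y₂ - y₁) ^ 2) := by
  -- Strict differentiability, since both endpoints of the increment vary.
  have hloc : ∀ a : ℝ, ∀ η > 0, ∃ ρ > 0, ∀ u v, |u - a| < ρ → |v - a| < ρ →
      |f u - f v - deriv f a * (u - v)| ≤ η * |u - v| := by
    intro a η hη
    have h1 : HasStrictDerivAt f (deriv f a) a := hf.contDiffAt.hasStrictDerivAt one_ne_zero
    have h2 := h1.isLittleO.def hη
    obtain ⟨ρ, hρ, h3⟩ := Metric.eventually_nhds_iff.1 h2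
    refine ⟨ρ, hρ, fun u v hu hv => ?_⟩
    have := @h3 (u, v) (by
      rw [Prod.dist_eq, Real.dist_eq, Real.dist_eq]
      exact max_lt hu hv)
    simpa [mul_comm] using this
  set A := deriv f y₀
  set B := deriv f x₀
  -- From `p² - q² = (p - q)(p + q)`: the first factor is at most `η (|dx| + |dy|)`, the second at
  -- most `K (|dx| + |dy|)` as `η ≤ 1`. The `2` in `ε / (2 * K)` pays for `(|dx| + |dy|)² ≤ 2 (dx² +
  -- dy²)`.
  set K := 2 * (|A| + |B|) + 1
  have hK : 0 < K := by positivity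
  have hη : 0 < min 1 (ε / (2 * K)) := lt_min one_pos (by positivity)
  set η := min 1 (ε / (2 * K))
  obtain ⟨ρ₁, hρ₁, h1⟩ := hloc y₀ η hη
  obtain ⟨ρ₂, hρ₂, h2⟩ := hloc x₀ η hη
  refine ⟨min ρ₁ ρ₂, lt_min hρ₁ hρ₂, fun y₁ y₂ x₁ x₂ hy₁ hy₂ hx₁ hx₂ => ?_⟩
  have h3 := h1 y₂ y₁ (hy₂.trans_le (min_le_left _ _)) (hy₁.trans_le (min_le_left _ _))
  have h4 := h2 x₂ x₁ (hx₂.trans_le (min_le_right _ _)) (hx₁.trans_le (min_le_right _ _))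
  set dy := y₂ - y₁
  set dx := x₂ - x₁
  set ey := f y₂ - f y₁ - A * dy
  set ex := f x₂ - f x₁ - B * dx
  have e1 : ((f y₂ - f x₂) - (f y₁ - f x₁)) ^ 2 - (A * dy - B * dx) ^ 2 =
      (ey - ex) * (2 * (A * dy) - 2 * (B * dx) + (ey - ex)) := by
    simp only [ey, ex]; ring
  rw [e1, abs_mul]
  have h5 : |ey - ex| ≤ η * (|dx| + |dy|) := by
    have := abs_sub ey ex
    linarith
  have h6 : |2 * (A * dy) - 2 * (B * dx) + (ey - ex)| ≤ K * (|dx| + |dy|) := by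
    have e2 : |2 * (A * dy)| = 2 * (|A| * |dy|) := by simp [abs_mul]
    have e3 : |2 * (B * dx)| = 2 * (|B| * |dx|) := by simp [abs_mul]
    have e4 := abs_add_le (2 * (A * dy) - 2 * (B * dx)) (ey - ex)
    have e5 := abs_sub (2 * (A * dy)) (2 * (B * dx))
    have e6 : η * (|dx| + |dy|) ≤ 1 * (|dx| + |dy|) := by
      gcongr
      exact min_le_left _ _
    have e7 : 0 ≤ |A| * |dx| := by positivity
    have e8 : 0 ≤ |B| * |dy| := by positivity
    simp only [K]
    nlinarith
  have h7 : (|dx| + |dy|) ^ 2 ≤ 2 * (dx ^ 2 + dy ^ 2) := by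
    have := sq_nonneg (|dx| - |dy|)
    nlinarith [sq_abs dx, sq_abs dy]
  calc |ey - ex| * |2 * (A * dy) - 2 * (B * dx) + (ey - ex)|
      ≤ (η * (|dx| + |dy|)) * (K * (|dx| + |dy|)) := by gcongr
    _ = η * K * (|dx| + |dy|) ^ 2 := by ring
    _ ≤ (ε / (2 * K)) * K * (2 * (dx ^ 2 + dy ^ 2)) := by
        gcongr
        exact min_le_right _ _
    _ = ε * (dx ^ 2 + dy ^ 2) := by field_simp

section Composition

variable {t : ℝ≥0} {ι : Type*} {l : Filter ι} {D : ι → TimePartition t}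
  {x y qx qcx qy qcy qw qcw : ℝ≥0 → ℝ}

/-- The sums of squared increments of linear combinations of `x` and `y` converge. -/
theorem IsPathQuadVar.exists_tendsto_linear (hx : IsPathQuadVar l D x qx qcx)
    (hy : IsPathQuadVar l D y qy qcy) (hw : IsPathQuadVar l D (fun s => y s - x s) qw qcw)
    (A B : ℝ) {a b : ℝ≥0} (hab : a < b) (hb : b ≤ t) :
    ∃ L, Tendsto (fun k => (D k).incrSum
      (fun u v => (A * (y v - y u) - B * (x v - x u)) ^ 2) a b) l (𝓝 L) := by
  obtain ⟨vx, hvx⟩ := exists_tendsto_incrSum_Ico (fun s hs => ⟨_, hx.tendsto s hs⟩) hab hb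
  obtain ⟨vy, hvy⟩ := exists_tendsto_incrSum_Ico (fun s hs => ⟨_, hy.tendsto s hs⟩) hab hb
  obtain ⟨vw, hvw⟩ := exists_tendsto_incrSum_Ico (fun s hs => ⟨_, hw.tendsto s hs⟩) hab hb
  -- Polarization: `(A dy - B dx)² = (B² - AB) dx² + (A² - AB) dy² + AB (dy - dx)²`. The quadratic
  -- variation of `y - x` handles the cross term.
  refine ⟨_, (((hvx.const_mul (B ^ 2 - A * B)).add (hvy.const_mul (A ^ 2 - A * B))).add
    (hvw.const_mul (A * B))).congr fun k => ?_⟩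
  rw [← (D k).incrSum_const_mul, ← (D k).incrSum_const_mul, ← (D k).incrSum_const_mul,
    ← (D k).incrSum_add, ← (D k).incrSum_add]
  refine (D k).incrSum_congr fun i _ _ _ => ?_
  simp only [sqIncr]
  ring

/-- If `x`, `y` and `y - x` have pathwise quadratic variations, then the sums of squared increments
of `f y - f x` converge. -/
theorem IsPathQuadVar.exists_tendsto_comp_sub [l.NeBot]
    (hD : Tendsto (fun k => (D k).mesh) l (𝓝 0)) (hxc : IsCadlag x) (hyc : IsCadlag y)
    (hx : IsPathQuadVar l D x qx qcx) (hy : IsPathQuadVar l D y qy qcy)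
    (hw : IsPathQuadVar l D (fun s => y s - x s) qw qcw) {f : ℝ → ℝ} (hf : ContDiff ℝ 1 f)
    {s : ℝ≥0} (hs : s ∈ Set.Ioc 0 t) :
    ∃ v, Tendsto (fun k => (D k).incrSum (sqIncr fun r => f (y r) - f (x r)) 0 s) l (𝓝 v) := by
  have hM := (hx.tendsto s hs).add (hy.tendsto s hs)
  simp_rw [← TimePartition.incrSum_add] at hM
  have hzc : IsCadlag fun r => f (y r) - f (x r) :=
    (hyc.comp hf.continuous).sub (hxc.comp hf.continuous)
  refine exists_tendsto_incrSum hD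
    (fun a b => add_nonneg (sqIncr_nonneg x a b) (sqIncr_nonneg y a b)) hs.1 hs.2 hM ?_ ?_
  · intro r hr ε hε
    -- After `r` the linearization is at the values at `r`; before `r`, at the left limits.
    obtain ⟨ρ, hρ, h⟩ := exists_abs_sq_sub_sq_le hf (y r) (x r) hε
    refine ⟨_, fun a b hab hb => hx.exists_tendsto_linear hy hw (deriv f (y r)) (deriv f (x r))
      hab (hb.trans hs.2), ?_⟩
    obtain ⟨s₁, hs₁, h1⟩ := hxc.exists_right r hρ
    obtain ⟨s₂, hs₂, h2⟩ := hyc.exists_right r hρ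
    refine ⟨min s₁ s₂, lt_min hs₁ hs₂, fun a b hra hab hb => ?_⟩
    have hb1 := hb.trans_le (min_le_left _ _)
    have hb2 := hb.trans_le (min_le_right _ _)
    exact h _ _ _ _ (h2 a hra (hab.trans hb2)) (h2 b (hra.trans hab.le) hb2)
      (h1 a hra (hab.trans hb1)) (h1 b (hra.trans hab.le) hb1)
  · intro r hr hrs ε hε
    have hrt := hrs.trans hs.2
    obtain ⟨ρ, hρ, h⟩ := exists_abs_sq_sub_sq_le hf (Function.leftLim y r)
      (Function.leftLim x r) hε
    refine ⟨fun u v => (deriv f (Function.leftLim y r) * (y v - y u) -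
        deriv f (Function.leftLim x r) * (x v - x u)) ^ 2,
      fun a b hab hb => hx.exists_tendsto_linear hy hw _ _ hab (hb.trans hs.2),
      ⟨_, (((hyc.tendsto_jump hD hr hrt).const_mul _).sub
        ((hxc.tendsto_jump hD hr hrt).const_mul _)).pow 2⟩,
      ⟨_, hzc.tendsto_sqIncr hD hr hrt⟩, ?_⟩
    obtain ⟨s₁, hs₁, h1⟩ := hxc.exists_left hr hρ
    obtain ⟨s₂, hs₂, h2⟩ := hyc.exists_left hr hρ
    refine ⟨max s₁ s₂, max_lt hs₁ hs₂, fun a b ha hab hb => ?_⟩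
    have ha1 := (le_max_left _ _).trans_lt ha
    have ha2 := (le_max_right _ _).trans_lt ha
    exact h _ _ _ _ (h2 a ha2 (hab.trans hb)) (h2 b (ha2.trans hab) hb)
      (h1 a ha1 (hab.trans hb)) (h1 b (ha1.trans hab) hb)

end Composition

/-! ### The continuous part of the limit -/

section ContinuousPart

variable {t : ℝ≥0} {ι : Type*} {l : Filter ι} {D : ι → TimePartition t}

/-- The terms are nonnegative, so the bound on finite sums from `sum_jump_le_of_tendsto` suffices.
-/
theorem summable_jump_of_tendsto [l.NeBot] (hD : Tendsto (fun k => (D k).mesh) l (𝓝 0))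
    {c : ℝ≥0 → ℝ≥0 → ℝ} (hc : ∀ a b, a ≤ t → b ≤ t → 0 ≤ c a b) {r s : ℝ≥0} (hst : s ≤ t) {v : ℝ}
    (hv : Tendsto (fun k => (D k).incrSum c r s) l (𝓝 v)) {cu : ℝ≥0 → ℝ}
    (hcu : ∀ u, 0 < u → u ≤ t → Tendsto (fun k => c ((D k).left u) ((D k).right u)) l (𝓝 (cu u))) :
    Summable ((Set.Ioc r s).indicator cu) ∧ ∑' u, (Set.Ioc r s).indicator cu u ≤ v := by
  have h0 : ∀ u, 0 ≤ (Set.Ioc r s).indicator cu u := by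
    intro u
    refine Set.indicator_nonneg (fun u hu => ?_) u
    have hu0 := zero_le.trans_lt hu.1
    have hut := hu.2.trans hst
    exact ge_of_tendsto' (hcu u hu0 hut) fun k =>
      hc _ _ ((D k).left_le hu0 hut) ((D k).right_le hu0 hut)
  have h1 : ∀ F : Finset ℝ≥0, ∑ u ∈ F, (Set.Ioc r s).indicator cu u ≤ v := by
    intro F
    classical
    have h2 : ∑ u ∈ F, (Set.Ioc r s).indicator cu u =
        ∑ u ∈ F.filter (fun u => u ∈ Set.Ioc r s), cu u := by
      rw [Finset.sum_filter]
      exact Finset.sum_congr rfl fun u _ => Set.indicator_apply _ _ _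
    rw [h2]
    refine TimePartition.sum_jump_le_of_tendsto hD hc hst hv _ (fun u hu => ?_) cu fun u hu => ?_
    · exact (Finset.mem_filter.1 hu).2
    · have := (Finset.mem_filter.1 hu).2
      exact hcu u (zero_le.trans_lt this.1) (this.2.trans hst)
  exact ⟨summable_of_sum_le h0 h1, Real.tsum_le_of_sum_le h0 h1⟩

theorem summable_jump_sq_of_tendsto [l.NeBot] (hD : Tendsto (fun k => (D k).mesh) l (𝓝 0))
    {z : ℝ≥0 → ℝ} (hz : IsCadlag z) {v : ℝ}
    (hv : Tendsto (fun k => (D k).incrSum (sqIncr z) 0 t) l (𝓝 v)) :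
    Summable ((Set.Icc 0 t).indicator fun u => jump z u ^ 2) := by
  refine (summable_jump_of_tendsto hD (fun a b _ _ => sqIncr_nonneg z a b) le_rfl hv
    fun u hu hut => hz.tendsto_sqIncr hD hu hut).1.congr fun u => ?_
  rcases eq_or_ne u 0 with rfl | h
  · simp [jump_zero]
  · simp [Set.indicator, pos_iff_ne_zero.2 h]

theorem jumpSum_sub {z : ℝ≥0 → ℝ}
    (hz : Summable ((Set.Icc 0 t).indicator fun u => jump z u ^ 2)) {r s : ℝ≥0} (hrs : r ≤ s)
    (hst : s ≤ t) :
    jumpSum z s - jumpSum z r = ∑' u, (Set.Ioc r s).indicator (fun u => jump z u ^ 2) u := by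
  have h1 : Summable ((Set.Icc 0 r).indicator fun u => jump z u ^ 2) :=
    summable_indicator_Icc hz (Set.Icc_subset_Icc_right (hrs.trans hst))
  have h2 : Summable ((Set.Ioc r s).indicator fun u => jump z u ^ 2) :=
    summable_indicator_Icc hz fun u hu => ⟨zero_le, hu.2.trans hst⟩
  have h3 := h1.tsum_add h2
  have h4 : (Set.Icc 0 s).indicator (fun u => jump z u ^ 2) =
      fun u => (Set.Icc 0 r).indicator (fun u => jump z u ^ 2) u +
        (Set.Ioc r s).indicator (fun u => jump z u ^ 2) u := by
    rw [← Set.Icc_union_Ioc_eq_Icc zero_le hrs, Set.indicator_union_of_disjoint]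
    rw [Set.disjoint_left]
    exact fun u hu hu' => absurd hu.2 (not_le.2 hu'.1)
  rw [jumpSum, jumpSum, h4, h3]
  ring

/-- The continuous part of `v`, where `v` jumps with the squared jumps of `z`. The value at `0`
is a limit. -/
noncomputable def contPart (t : ℝ≥0) (z v : ℝ≥0 → ℝ) (s : ℝ≥0) : ℝ :=
  -- A limit along a sequence of times, so that measurability at time `0` can be obtained from
  -- right-continuity of the filtration.
  if s = 0 then limUnder atTop fun j : ℕ => v (t / (j + 1)) - jumpSum z (t / (j + 1))
  else v s - jumpSum z s

/-- A function on `(0, t]` with increments between `0` and those of a continuous function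
extends to `[0, t]`. -/
theorem exists_extend_of_sub_le (ht : 0 < t) {G H : ℝ≥0 → ℝ} (hH : ContinuousOn H (Set.Icc 0 t))
    (hG : ∀ r s, 0 < r → r < s → s ≤ t → G r ≤ G s ∧ G s - G r ≤ H s - H r) :
    ∃ g, Tendsto G (𝓝[>] 0) (𝓝 g) ∧
      ContinuousOn (fun s => if s = 0 then g else G s) (Set.Icc 0 t) ∧
      MonotoneOn (fun s => if s = 0 then g else G s) (Set.Icc 0 t) := by
  have hH0 : Tendsto H (𝓝[>] 0) (𝓝 (H 0)) := by
    refine (hH 0 ⟨le_rfl, ht.le⟩).tendsto.mono_left (nhdsWithin_le_iff.2 ?_)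
    filter_upwards [Ioo_mem_nhdsGT ht] with r hr using ⟨zero_le, hr.2.le⟩
  have hHr : ∀ᶠ r in 𝓝[>] 0, H 0 - 1 < H r := hH0.eventually_const_lt (by linarith)
  obtain ⟨b₀, hb₀, hb⟩ := (mem_nhdsGT_iff_exists_Ioo_subset' ht).1 hHr
  have hb₀' : 0 < min b₀ t := lt_min hb₀ ht
  set b := min b₀ t
  have hmono : MonotoneOn G (Set.Ioo 0 b) := by
    intro r hr s hs hrs
    rcases hrs.eq_or_lt with rfl | h
    · exact le_rfl
    · exact (hG r s hr.1 h (hs.2.le.trans (min_le_right _ _))).1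
  have hbdd : BddBelow (G '' Set.Ioo 0 b) := by
    refine ⟨G t - (H t - (H 0 - 1)), ?_⟩
    rintro _ ⟨r, hr, rfl⟩
    have h1 := (hG r t hr.1 (hr.2.trans_le (min_le_right _ _)) le_rfl).2
    have h2 : H 0 - 1 < H r := hb ⟨hr.1, hr.2.trans_le (min_le_left _ _)⟩
    linarith
  have hlim := hmono.tendsto_nhdsWithin_Ioo_right (Set.nonempty_Ioo.2 hb₀') hbdd
  set g := sInf (G '' Set.Ioo 0 b)
  have key : ∀ r s, r ≤ s → s ≤ t →
      (if r = 0 then g else G r) ≤ (if s = 0 then g else G s) ∧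
      (if s = 0 then g else G s) - (if r = 0 then g else G r) ≤ H s - H r := by
    intro r s hrs hst
    rcases hrs.eq_or_lt with rfl | h
    · simp
    have hs0 := (zero_le.trans_lt h).ne'
    rw [if_neg hs0]
    split_ifs with hr
    · subst hr
      constructor
      · refine le_of_tendsto hlim ?_
        filter_upwards [Ioo_mem_nhdsGT h] with r hr using (hG r s hr.1 hr.2 hst).1
      · refine le_of_tendsto_of_tendsto (hlim.const_sub (G s)) (hH0.const_sub (H s)) ?_
        filter_upwards [Ioo_mem_nhdsGT h] with r hr using (hG r s hr.1 hr.2 hst).2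
    · exact hG r s (pos_iff_ne_zero.2 hr) h hst
  refine ⟨g, hlim, ?_, fun r _ s hs hrs => (key r s hrs hs.2).1⟩
  intro s hs
  have h1 : Tendsto (fun r => |H r - H s|) (𝓝[Set.Icc 0 t] s) (𝓝 0) := by
    simpa using ((hH s hs).tendsto.sub_const (H s)).abs
  rw [ContinuousWithinAt, tendsto_iff_dist_tendsto_zero]
  refine squeeze_zero' (Eventually.of_forall fun _ => dist_nonneg) ?_ h1
  filter_upwards [self_mem_nhdsWithin] with r hr
  rw [Real.dist_eq]
  rcases le_total r s with h | h
  · obtain ⟨h2, h3⟩ := key r s h hs.2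
    rw [abs_sub_comm, abs_of_nonneg (sub_nonneg.2 h2), abs_sub_comm]
    exact h3.trans (le_abs_self _)
  · obtain ⟨h2, h3⟩ := key s r h hr.2
    rw [abs_of_nonneg (sub_nonneg.2 h2)]
    exact h3.trans (le_abs_self _)

/-- The Fatou inequality for jumps is used twice. For `dz²` it makes `v - jumpSum z` increasing; for
`K (dx² + dy²) - dz² ≥ 0` it bounds the increments of `v - jumpSum z` by those of `K (qcx + qcy)`,
from which continuity is inherited. -/
theorem isJumpDecomp_contPart [l.NeBot] (hD : Tendsto (fun k => (D k).mesh) l (𝓝 0)) (ht : 0 < t)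
    {x y z qx qcx qy qcy v : ℝ≥0 → ℝ} (hxc : IsCadlag x) (hyc : IsCadlag y) (hzc : IsCadlag z)
    (hx : IsPathQuadVar l D x qx qcx) (hy : IsPathQuadVar l D y qy qcy) {K : ℝ}
    (hK : ∀ a b, a ≤ t → b ≤ t → sqIncr z a b ≤ K * (sqIncr x a b + sqIncr y a b))
    (hv : ∀ s ∈ Set.Ioc 0 t, Tendsto (fun k => (D k).incrSum (sqIncr z) 0 s) l (𝓝 (v s))) :
    IsJumpDecomp t z v (contPart t z v) ∧
      Tendsto (fun j : ℕ => v (t / (j + 1)) - jumpSum z (t / (j + 1))) atTop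
        (𝓝 (contPart t z v 0)) := by
  have hsz := summable_jump_sq_of_tendsto hD hzc (hv t ⟨ht, le_rfl⟩)
  have hsx := hx.summable ht
  have hsy := hy.summable ht
  have hIoc : ∀ {c : ℝ≥0 → ℝ≥0 → ℝ} {w : ℝ≥0 → ℝ},
      (∀ s ∈ Set.Ioc 0 t, Tendsto (fun k => (D k).incrSum c 0 s) l (𝓝 (w s))) →
      ∀ r s, 0 < r → r < s → s ≤ t →
        Tendsto (fun k => (D k).incrSum c r s) l (𝓝 (w s - w r)) := by
    intro c w hw r s hr hrs hst
    refine ((hw s ⟨hr.trans hrs, hst⟩).sub (hw r ⟨hr, hrs.le.trans hst⟩)).congr fun k => ?_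
    rw [(D k).incrSum_split c zero_le hrs.le]
    ring
  have hG : ∀ r s, 0 < r → r < s → s ≤ t →
      v r - jumpSum z r ≤ v s - jumpSum z s ∧
      (v s - jumpSum z s) - (v r - jumpSum z r) ≤
        K * (qcx s + qcy s) - K * (qcx r + qcy r) := by
    intro r s hr hrs hst
    have hsub : Set.Ioc r s ⊆ Set.Icc 0 t := fun u hu => ⟨zero_le, hu.2.trans hst⟩
    have hz1 := hIoc hv r s hr hrs hst
    have h1 := (summable_jump_of_tendsto hD (fun a b _ _ => sqIncr_nonneg z a b) hst hz1
      fun u hu hut => hzc.tendsto_sqIncr hD hu hut).2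
    rw [← jumpSum_sub hsz hrs.le hst] at h1
    refine ⟨by linarith, ?_⟩
    have h2 := (((hIoc hx.tendsto r s hr hrs hst).add (hIoc hy.tendsto r s hr hrs hst)).const_mul
      K).sub hz1
    simp_rw [← TimePartition.incrSum_add, ← TimePartition.incrSum_const_mul,
      ← TimePartition.incrSum_sub] at h2
    have h3 := (summable_jump_of_tendsto hD (fun a b ha hb => sub_nonneg.2 (hK a b ha hb)) hst h2
      (cu := fun u => K * (jump x u ^ 2 + jump y u ^ 2) - jump z u ^ 2) fun u hu hut =>
        (((hxc.tendsto_sqIncr hD hu hut).add (hyc.tendsto_sqIncr hD hu hut)).const_mul K).sub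
          (hzc.tendsto_sqIncr hD hu hut)).2
    have h4 := ((((summable_indicator_Icc hsx hsub).hasSum.add
      (summable_indicator_Icc hsy hsub).hasSum).mul_left K).sub
        (summable_indicator_Icc hsz hsub).hasSum).tsum_eq
    have h5 : (Set.Ioc r s).indicator
        (fun u => K * (jump x u ^ 2 + jump y u ^ 2) - jump z u ^ 2) = fun u =>
        K * ((Set.Ioc r s).indicator (fun u => jump x u ^ 2) u +
          (Set.Ioc r s).indicator (fun u => jump y u ^ 2) u) -
          (Set.Ioc r s).indicator (fun u => jump z u ^ 2) u := by
      funext u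
      by_cases hu : u ∈ Set.Ioc r s
      · simp only [Set.indicator_of_mem hu]
      · simp only [Set.indicator_of_notMem hu]; ring
    rw [h5, h4, ← jumpSum_sub hsx hrs.le hst, ← jumpSum_sub hsy hrs.le hst,
      ← jumpSum_sub hsz hrs.le hst, hx.eq_add ⟨hr, hrs.le.trans hst⟩,
      hx.eq_add ⟨hr.trans hrs, hst⟩, hy.eq_add ⟨hr, hrs.le.trans hst⟩,
      hy.eq_add ⟨hr.trans hrs, hst⟩] at h3
    linarith
  obtain ⟨g, hg, hcont, hmono⟩ := exists_extend_of_sub_le ht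
    (G := fun s => v s - jumpSum z s) (H := fun s => K * (qcx s + qcy s))
    (continuousOn_const.mul (hx.cont.add hy.cont)) hG
  have hseq : Tendsto (fun j : ℕ => t / ((j : ℝ≥0) + 1)) atTop (𝓝[>] 0) := by
    refine tendsto_nhdsWithin_iff.2 ⟨?_, Eventually.of_forall fun j => ?_⟩
    · simpa [div_eq_mul_inv] using
        (tendsto_one_div_add_atTop_nhds_zero_nat (𝕜 := ℝ≥0)).const_mul t
    · exact div_pos ht (by positivity)
  have hlim : contPart t z v 0 = g := by
    rw [contPart, if_pos rfl]
    exact (hg.comp hseq).limUnder_eq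
  have heq : contPart t z v = fun s => if s = 0 then g else v s - jumpSum z s := by
    funext s
    split_ifs with h
    · rw [h, hlim]
    · rw [contPart, if_neg h]
  refine ⟨⟨heq ▸ hcont, heq ▸ hmono, fun s hs => ?_⟩, hlim ▸ hg.comp hseq⟩
  refine (hasSum_subtype_iff_indicator (f := fun u => jump z u ^ 2) (s := Set.Icc 0 s)).2 ?_
  rw [contPart, if_neg hs.1.ne', sub_sub_cancel]
  exact (summable_indicator_Icc hsz (Set.Icc_subset_Icc_right hs.2)).hasSum

end ContinuousPart

/-! ### Second differences of a `C²` function -/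

section Estimates

/-- A `C²` function is Lipschitz with Lipschitz derivative on bounded intervals; this bounds the
mixed second difference. -/
theorem exists_abs_second_difference_le {f : ℝ → ℝ} (hf : ContDiff ℝ 2 f) (B : ℝ) :
    ∃ K, 0 ≤ K ∧ ∀ x₁ x₂ y₁ y₂, |x₁| ≤ B → |x₂| ≤ B → |y₁| ≤ B → |y₂| ≤ B →
      |(f y₂ - f x₂) - (f y₁ - f x₁)| ≤
        K * (|(y₂ - x₂) - (y₁ - x₁)| + |y₁ - x₁| * |x₂ - x₁|) := by
  have hf1 : ContDiff ℝ 1 (deriv f) := ((contDiff_succ_iff_deriv (n := 1)).1 hf).2.2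
  have hd : Differentiable ℝ f := hf.differentiable two_ne_zero
  have hd1 : Differentiable ℝ (deriv f) := hf1.differentiable one_ne_zero
  -- The radius `3 * B` contains the points `x + w` with `|x| ≤ B` and `|w| ≤ 2 * B`.
  obtain ⟨K₁, hK₁⟩ := (isCompact_Icc (a := -(3 * B)) (b := 3 * B)).exists_bound_of_continuousOn
    hf1.continuous.continuousOn
  obtain ⟨K₂, hK₂⟩ := (isCompact_Icc (a := -(3 * B)) (b := 3 * B)).exists_bound_of_continuousOn
    (hf1.continuous_deriv le_rfl).continuousOn
  have hconv : ∀ c : ℝ, Convex ℝ (Set.Icc (-c) c) := fun c => convex_Icc _ _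
  have hl1 : ∀ u v, |u| ≤ 3 * B → |v| ≤ 3 * B → |f v - f u| ≤ K₁ * |v - u| := by
    intro u v hu hv
    exact (hconv (3 * B)).norm_image_sub_le_of_norm_deriv_le (fun x _ => hd x) hK₁
      (abs_le.1 hu) (abs_le.1 hv)
  have hl2 : ∀ u v, |u| ≤ 3 * B → |v| ≤ 3 * B → |deriv f v - deriv f u| ≤ K₂ * |v - u| := by
    intro u v hu hv
    exact (hconv (3 * B)).norm_image_sub_le_of_norm_deriv_le (fun x _ => hd1 x) hK₂
      (abs_le.1 hu) (abs_le.1 hv)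
  refine ⟨max (max K₁ K₂) 0, le_max_right _ _, fun x₁ x₂ y₁ y₂ hx₁ hx₂ hy₁ hy₂ => ?_⟩
  have hB : 0 ≤ B := (abs_nonneg _).trans hx₁
  -- Compare through `f (x₂ + w)`: the first piece uses the Lipschitz bound of `f`, the second the
  -- mean value inequality for `x ↦ f (x + w) - f x`, whose derivative is at most `K₂ |w|`.
  set w := y₁ - x₁
  have hw : |w| ≤ 2 * B := by
    have := abs_sub y₁ x₁
    linarith
  have h1 : |f y₂ - f (x₂ + w)| ≤ K₁ * |(y₂ - x₂) - w| := by
    have := hl1 (x₂ + w) y₂ ((abs_add_le _ _).trans (by linarith)) (by linarith)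
    rwa [show y₂ - (x₂ + w) = (y₂ - x₂) - w by ring] at this
  have h2 : |(f (x₂ + w) - f x₂) - (f (x₁ + w) - f x₁)| ≤ K₂ * |w| * |x₂ - x₁| := by
    have hg : ∀ x, HasDerivAt (fun x => f (x + w) - f x) (deriv f (x + w) - deriv f x) x :=
      fun x => ((hd (x + w)).hasDerivAt.comp_add_const x w).sub (hd x).hasDerivAt
    refine (hconv B).norm_image_sub_le_of_norm_hasDerivWithin_le
      (f := fun x => f (x + w) - f x) (f' := fun x => deriv f (x + w) - deriv f x)
      (fun x _ => (hg x).hasDerivWithinAt) (fun x hx => ?_) (abs_le.1 hx₁) (abs_le.1 hx₂)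
    have hxB : |x| ≤ B := abs_le.2 hx
    have := hl2 x (x + w) (by linarith) ((abs_add_le _ _).trans (by linarith))
    simpa using this
  rw [show x₁ + w = y₁ by simp [w]] at h2
  have h3 : (f y₂ - f x₂) - (f y₁ - f x₁) =
      (f y₂ - f (x₂ + w)) + ((f (x₂ + w) - f x₂) - (f y₁ - f x₁)) := by ring
  rw [h3, mul_add]
  refine (abs_add_le _ _).trans (add_le_add (h1.trans ?_) (h2.trans ?_))
  · gcongr
    exact (le_max_left _ _).trans (le_max_left _ _)
  · rw [mul_assoc]
    gcongr
    exact (le_max_right _ _).trans (le_max_left _ _)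

/-- The weight `(y₁ - x₁) ^ 2` sits at the left endpoint, so that in the limit it becomes an
integrand of left limits against `[x]`. -/
theorem exists_sq_second_difference_le {f : ℝ → ℝ} (hf : ContDiff ℝ 2 f) (B : ℝ) :
    ∃ K, 0 ≤ K ∧ ∀ x₁ x₂ y₁ y₂, |x₁| ≤ B → |x₂| ≤ B → |y₁| ≤ B → |y₂| ≤ B →
      ((f y₂ - f x₂) - (f y₁ - f x₁)) ^ 2 ≤
        K * (((y₂ - x₂) - (y₁ - x₁)) ^ 2 + (y₁ - x₁) ^ 2 * (x₂ - x₁) ^ 2) := by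
  obtain ⟨K, hK, h⟩ := exists_abs_second_difference_le hf B
  refine ⟨2 * K ^ 2, by positivity, fun x₁ x₂ y₁ y₂ hx₁ hx₂ hy₁ hy₂ => ?_⟩
  have h1 := h x₁ x₂ y₁ y₂ hx₁ hx₂ hy₁ hy₂
  set p := (y₂ - x₂) - (y₁ - x₁)
  set q := (y₁ - x₁)
  set r := x₂ - x₁
  have h2 := pow_le_pow_left₀ (abs_nonneg _) h1 2
  rw [sq_abs, mul_pow] at h2
  have h3 : (|p| + |q| * |r|) ^ 2 ≤ 2 * (p ^ 2 + q ^ 2 * r ^ 2) := by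
    have h4 := add_sq_le (a := |p|) (b := |q| * |r|)
    rwa [mul_pow, sq_abs, sq_abs, sq_abs] at h4
  calc _ ≤ _ := h2
    _ ≤ K ^ 2 * (2 * (p ^ 2 + q ^ 2 * r ^ 2)) := by gcongr
    _ = _ := by ring

/-- The cruder domination that `isJumpDecomp_contPart` requires. -/
theorem exists_sq_difference_le {f : ℝ → ℝ} (hf : ContDiff ℝ 2 f) (B : ℝ) :
    ∃ K, ∀ x₁ x₂ y₁ y₂, |x₁| ≤ B → |x₂| ≤ B → |y₁| ≤ B → |y₂| ≤ B →
      ((f y₂ - f x₂) - (f y₁ - f x₁)) ^ 2 ≤ K * ((x₂ - x₁) ^ 2 + (y₂ - y₁) ^ 2) := by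
  obtain ⟨K, hK, h⟩ := exists_sq_second_difference_le hf B
  refine ⟨K * (2 + 4 * B ^ 2), fun x₁ x₂ y₁ y₂ hx₁ hx₂ hy₁ hy₂ => ?_⟩
  refine (h x₁ x₂ y₁ y₂ hx₁ hx₂ hy₁ hy₂).trans ?_
  rw [mul_assoc]
  gcongr
  have h1 : (y₁ - x₁) ^ 2 ≤ 4 * B ^ 2 := by
    have h2 := sq_le_sq.2 (((abs_sub y₁ x₁).trans (by linarith)).trans (le_abs_self (2 * B)))
    linarith
  have h2 : ((y₂ - x₂) - (y₁ - x₁)) ^ 2 ≤ 2 * ((x₂ - x₁) ^ 2 + (y₂ - y₁) ^ 2) := by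
    have := sq_nonneg ((y₂ - y₁) + (x₂ - x₁))
    linarith
  have h3 : (y₁ - x₁) ^ 2 * (x₂ - x₁) ^ 2 ≤ 4 * B ^ 2 * ((x₂ - x₁) ^ 2 + (y₂ - y₁) ^ 2) := by
    gcongr
    linarith [sq_nonneg (y₂ - y₁)]
  linarith

end Estimates

/-! ### Weighted sums and the Stieltjes measure of the quadratic variation -/

section StieltjesMeasure

variable {t : ℝ≥0} {ι : Type*} {l : Filter ι} {D : ι → TimePartition t} {x q qc : ℝ≥0 → ℝ}

theorem IsPathQuadVar.monotone [l.NeBot] (hx : IsPathQuadVar l D x q qc) {r s : ℝ≥0} (hr : 0 < r)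
    (hrs : r ≤ s) (hst : s ≤ t) : q r ≤ q s :=
  le_of_tendsto_of_tendsto' (hx.tendsto r ⟨hr, hrs.trans hst⟩) (hx.tendsto s ⟨hr.trans_le hrs, hst⟩)
    fun k => (D k).incrSum_mono (sqIncr_nonneg x) le_rfl hrs

/-- The value `qc 0` is the mass that the squared increments leave at time `0`. -/
theorem IsPathQuadVar.tendsto_zero (hx : IsPathQuadVar l D x q qc) (ht : 0 < t) :
    Tendsto q (𝓝[>] 0) (𝓝 (qc 0)) := by
  simpa [jumpSum_zero] using hx.tendsto_right ht

/-- The quadratic variation of a path, as a Stieltjes function. -/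
noncomputable def IsPathQuadVar.stieltjes [l.NeBot] (hx : IsPathQuadVar l D x q qc) (ht : 0 < t) :
    StieltjesFunction ℝ≥0 where
  -- `q 0` is arbitrary, so the right limit `qc 0` takes its place; beyond `t` the function is
  -- constant.
  toFun s := if s = 0 then qc 0 else q (min s t)
  mono' := by
    intro r s hrs
    rcases eq_or_ne r 0 with rfl | hr
    · rcases eq_or_ne s 0 with rfl | hs
      · exact le_rfl
      · simp only [if_pos, if_neg hs]
        have hs' := lt_min (pos_iff_ne_zero.2 hs) ht
        refine le_of_tendsto (hx.tendsto_zero ht) ?_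
        filter_upwards [Ioo_mem_nhdsGT hs'] with r hr using
          hx.monotone hr.1 hr.2.le (min_le_right _ _)
    · have hr' := pos_iff_ne_zero.2 hr
      simp only [if_neg hr, if_neg (hr'.trans_le hrs).ne']
      exact hx.monotone (lt_min hr' ht) (min_le_min_right _ hrs) (min_le_right _ _)
  right_continuous' := by
    intro s
    rw [← continuousWithinAt_Ioi_iff_Ici]
    rcases eq_or_ne s 0 with rfl | hs
    · rw [ContinuousWithinAt, if_pos rfl]
      refine (hx.tendsto_zero ht).congr' ?_
      filter_upwards [Ioo_mem_nhdsGT ht] with r hr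
      rw [if_neg hr.1.ne', min_eq_left hr.2.le]
    · have hs' := pos_iff_ne_zero.2 hs
      rw [ContinuousWithinAt, if_neg hs]
      rcases lt_or_ge s t with hst | hst
      · rw [min_eq_left hst.le, hx.eq_add ⟨hs', hst.le⟩]
        refine (hx.tendsto_right hst).congr' ?_
        filter_upwards [Ioo_mem_nhdsGT hst] with r hr
        rw [if_neg (hs'.trans hr.1).ne', min_eq_left hr.2.le]
      · rw [min_eq_right hst]
        refine Tendsto.congr' ?_ tendsto_const_nhds
        filter_upwards [self_mem_nhdsWithin] with r hr
        rw [if_neg (hs'.trans hr).ne', min_eq_right (hst.trans (le_of_lt hr))]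

/-- The mass `qc 0` at time `0` is not assumed to vanish and is not seen by the measure of `(0, b]`,
so it is added separately. -/
theorem IsPathQuadVar.tendsto_incrSum_Ioc [l.NeBot] (hx : IsPathQuadVar l D x q qc) (ht : 0 < t)
    {a b : ℝ≥0} (hab : a < b) (hbt : b ≤ t) :
    Tendsto (fun k => (D k).incrSum (sqIncr x) a b) l
      (𝓝 ((hx.stieltjes ht).measure.real (Set.Ioc a b) + if a = 0 then qc 0 else 0)) := by
  have hb := zero_le.trans_lt hab
  rw [measureReal_def, StieltjesFunction.measure_Ioc,
    ENNReal.toReal_ofReal (sub_nonneg.2 ((hx.stieltjes ht).mono hab.le))]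
  have e1 : hx.stieltjes ht b = q b := by
    change (if b = 0 then qc 0 else q (min b t)) = q b
    rw [if_neg hb.ne', min_eq_left hbt]
  rcases eq_or_ne a 0 with rfl | ha
  · have e2 : hx.stieltjes ht 0 = qc 0 := if_pos rfl
    rw [e1, e2, if_pos rfl, sub_add_cancel]
    exact hx.tendsto b ⟨hb, hbt⟩
  · have e2 : hx.stieltjes ht a = q a := by
      change (if a = 0 then qc 0 else q (min a t)) = q a
      rw [if_neg ha, min_eq_left (hab.le.trans hbt)]
    rw [e1, e2, if_neg ha, add_zero]
    refine ((hx.tendsto b ⟨hb, hbt⟩).sub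
      (hx.tendsto a ⟨pos_iff_ne_zero.2 ha, hab.le.trans hbt⟩)).congr fun k => ?_
    rw [(D k).incrSum_split _ zero_le hab.le]
    ring

theorem IsPathQuadVar.measure_Ioc_lt_top [l.NeBot] (hx : IsPathQuadVar l D x q qc) (ht : 0 < t)
    (a b : ℝ≥0) : (hx.stieltjes ht).measure (Set.Ioc a b) < ∞ := by
  rw [StieltjesFunction.measure_Ioc]
  exact ENNReal.ofReal_lt_top

theorem IsCadlag.integrableOn_leftLim {μ : Measure ℝ≥0} {G : ℝ≥0 → ℝ} (hG : IsCadlag G)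
    (ht : 0 < t) {a b : ℝ≥0} (hb : b ≤ t) (hμ : μ (Set.Ioc a b) < ∞) :
    IntegrableOn (Function.leftLim G) (Set.Ioc a b) μ := by
  obtain ⟨B, hB⟩ := hG.exists_bound ht
  refine Measure.integrableOn_of_bounded (M := B) hμ.ne
    hG.measurable_leftLim.aestronglyMeasurable ?_
  refine (ae_restrict_iff' measurableSet_Ioc).2 (Eventually.of_forall fun u hu => ?_)
  exact hG.abs_leftLim_le hB (hu.2.trans hb)

/-- Sums of squared increments of `x` weighted by the left values of a cadlag path `G` are
asymptotically at most the integral of the left limits of `G` against the quadratic variation. -/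
theorem IsPathQuadVar.eventually_weighted_le [l.NeBot]
    (hx : IsPathQuadVar l D x q qc) (ht : 0 < t) {G : ℝ≥0 → ℝ} (hG : IsCadlag G) {ε : ℝ}
    (hε : 0 < ε) :
    ∀ᶠ k in l, (D k).incrSum (fun a b => G a * sqIncr x a b) 0 t ≤
      (∫ u in Set.Ioc 0 t, Function.leftLim G u ∂(hx.stieltjes ht).measure) + G 0 * qc 0 + ε := by
  set μ := (hx.stieltjes ht).measure with hμdef
  have hμ : ∀ a b, μ (Set.Ioc a b) < ∞ := hx.measure_Ioc_lt_top ht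
  -- The premise `t ≤ t` is the instance at `b = t` of the side condition in the induction relation
  -- below.
  have key : ∀ ε > 0, t ≤ t → ∀ᶠ k in l, (D k).incrSum (fun a b => G a * sqIncr x a b) 0 t ≤
      (∫ u in Set.Ioc 0 t, Function.leftLim G u ∂μ) + (if (0 : ℝ≥0) = 0 then G 0 * qc 0 else 0) +
        ε * ((D k).incrSum (sqIncr x) 0 t + μ.real (Set.Ioc 0 t) + ((t : ℝ) - (0 : ℝ≥0))) := by
    intro ε hε
    -- Both sides are compared with `A` times the mass. Only `G` on `[a, b)` and its left limits on
    -- `(a, b]` enter, so a jump of `G` at `b` does no harm. At `a = 0` the mass `qc 0` needs its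
    -- exact weight `G 0`.
    have base : ∀ A : ℝ, ∀ a b : ℝ≥0, a < b → b ≤ t → (∀ u, a ≤ u → u < b → G u ≤ A + ε) →
        (∀ u, a < u → u ≤ b → A - ε ≤ Function.leftLim G u) → (a = 0 → A = G 0) →
        ∀ᶠ k in l, (D k).incrSum (fun a b => G a * sqIncr x a b) a b ≤
          (∫ u in Set.Ioc a b, Function.leftLim G u ∂μ) + (if a = 0 then G 0 * qc 0 else 0) +
          ε * ((D k).incrSum (sqIncr x) a b + μ.real (Set.Ioc a b) + ((b : ℝ) - a)) := by
      intro A a b hab hbt h1 h2 h3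
      have h4 := (hx.tendsto_incrSum_Ioc ht hab hbt).const_mul A
      have hpos : 0 < ε * ((b : ℝ) - a) := mul_pos hε (sub_pos.2 (by exact_mod_cast hab))
      have h5 : (A - ε) * μ.real (Set.Ioc a b) ≤ ∫ u in Set.Ioc a b, Function.leftLim G u ∂μ := by
        have h6 : ∫ u in Set.Ioc a b, (A - ε) ∂μ ≤ ∫ u in Set.Ioc a b, Function.leftLim G u ∂μ :=
          setIntegral_mono_on (integrableOn_const (hμ a b).ne)
            (hG.integrableOn_leftLim ht hbt (hμ a b)) measurableSet_Ioc fun u hu => h2 u hu.1 hu.2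
        rwa [setIntegral_const, smul_eq_mul, mul_comm] at h6
      have h7 : A * (if a = 0 then qc 0 else 0) = if a = 0 then G 0 * qc 0 else 0 := by
        split_ifs with h
        · rw [h3 h]
        · simp
      filter_upwards [h4.eventually_lt_const (lt_add_of_pos_right _ hpos)] with k hk
      have h8 : (D k).incrSum (fun a b => G a * sqIncr x a b) a b ≤
          (A + ε) * (D k).incrSum (sqIncr x) a b := by
        rw [← (D k).incrSum_const_mul]
        exact (D k).incrSum_le fun i _ hi1 hi2 =>
          mul_le_mul_of_nonneg_right (h1 _ hi1 hi2) (sqIncr_nonneg _ _ _)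
      rw [mul_add, h7] at hk
      linarith
    refine interval_induction (R := fun a b => b ≤ t → ∀ᶠ k in l,
        (D k).incrSum (fun a b => G a * sqIncr x a b) a b ≤
          (∫ u in Set.Ioc a b, Function.leftLim G u ∂μ) + (if a = 0 then G 0 * qc 0 else 0) +
          ε * ((D k).incrSum (sqIncr x) a b + μ.real (Set.Ioc a b) + ((b : ℝ) - a))) ht ?_ ?_ ?_
    · intro a b d hab hbd h1 h2 hdt
      have hbt := hbd.le.trans hdt
      have hdisj : Disjoint (Set.Ioc a b) (Set.Ioc b d) := Set.Ioc_disjoint_Ioc_of_le le_rfl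
      have e1 : ∫ u in Set.Ioc a d, Function.leftLim G u ∂μ =
          (∫ u in Set.Ioc a b, Function.leftLim G u ∂μ) +
            ∫ u in Set.Ioc b d, Function.leftLim G u ∂μ := by
        rw [← Set.Ioc_union_Ioc_eq_Ioc hab.le hbd.le]
        exact setIntegral_union hdisj measurableSet_Ioc
          (hG.integrableOn_leftLim ht hbt (hμ a b)) (hG.integrableOn_leftLim ht hdt (hμ b d))
      have e2 : μ.real (Set.Ioc a d) = μ.real (Set.Ioc a b) + μ.real (Set.Ioc b d) := by
        rw [← Set.Ioc_union_Ioc_eq_Ioc hab.le hbd.le]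
        exact measureReal_union hdisj measurableSet_Ioc (hμ a b).ne (hμ b d).ne
      filter_upwards [h1 hbt, h2 hdt] with k hk1 hk2
      rw [if_neg (zero_le.trans_lt hab).ne'] at hk2
      rw [e1, e2, (D k).incrSum_split _ hab.le hbd.le,
        (D k).incrSum_split (sqIncr x) hab.le hbd.le]
      linarith
    · intro s _ _
      obtain ⟨s₁, hs₁, h1⟩ := hG.exists_right s hε
      refine ⟨s₁, hs₁, fun r hsr hr _ hrt => base (G s) s r hsr hrt (fun u hu hur => ?_)
        (fun u hu hur => ?_) fun h => by rw [h]⟩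
      · have := abs_lt.1 (h1 u hu (hur.trans hr))
        linarith
      · have := abs_le.1 (hG.abs_leftLim_sub_le (v := G s) (η := ε)
          (fun a ha hau => (h1 a ha.le (hau.trans (hur.trans_lt hr))).le) hu)
        linarith
    · intro s hs _
      obtain ⟨s₀, hs₀, h1⟩ := hG.exists_left hs hε
      refine ⟨s₀, hs₀, fun r hr hrs _ hst => base (Function.leftLim G s) r s hrs hst
        (fun u hu hur => ?_) (fun u hu hur => ?_)
        fun h => absurd h (zero_le.trans_lt hr).ne'⟩
      · have := abs_lt.1 (h1 u (hr.trans_le hu) hur)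
        linarith
      · have := abs_le.1 (hG.abs_leftLim_sub_le (v := Function.leftLim G s) (η := ε)
          (fun a ha hau => (h1 a (hr.trans ha) (hau.trans_le hur)).le) hu)
        linarith
  have hq0 : 0 ≤ q t := ge_of_tendsto' (hx.tendsto t ⟨ht, le_rfl⟩) fun k =>
    (D k).incrSum_nonneg (sqIncr_nonneg x) _ _
  have hKpos : 0 < q t + 1 + μ.real (Set.Ioc 0 t) + t := by
    have := measureReal_nonneg (μ := μ) (s := Set.Ioc 0 t)
    have : (0 : ℝ) ≤ t := t.2
    linarith
  set K := q t + 1 + μ.real (Set.Ioc 0 t) + t with hK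
  filter_upwards [key (ε / K) (by positivity) le_rfl,
    (hx.tendsto t ⟨ht, le_rfl⟩).eventually_lt_const (lt_add_one _)] with k hk hk2
  refine hk.trans ?_
  rw [if_pos rfl]
  gcongr
  calc ε / K * _ ≤ ε / K * K := by
        gcongr
        rw [hK, NNReal.coe_zero, sub_zero]
        linarith
    _ = ε := by field_simp

end StieltjesMeasure

/-! ### Almost sure subsequences -/

section Subsequences

variable {Ω : Type*} [mΩ : MeasurableSpace Ω] {P : Measure Ω}

/-- Countably many sequences that converge in measure have a common subsequence along which all of
them converge almost everywhere. -/
theorem exists_seq_forall_tendsto_ae {β : Type*} [Countable β] {T : β → ℕ → Ω → ℝ}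
    {g : β → Ω → ℝ} (h : ∀ j, TendstoInMeasure P (T j) atTop (g j)) :
    ∃ ns : ℕ → ℕ, StrictMono ns ∧
      ∀ᵐ ω ∂P, ∀ j, Tendsto (fun k => T j (ns k) ω) atTop (𝓝 (g j ω)) := by
  rcases isEmpty_or_nonempty β with hβ | hβ
  · exact ⟨id, strictMono_id, Eventually.of_forall fun ω j => hβ.elim j⟩
  obtain ⟨e, he⟩ := exists_surjective_nat β
  -- At stage `n` the first `n + 1` sequences are controlled at once, so the Borel–Cantelli argument
  -- for sequence `i` starts at stage `i`.
  have h1 : ∀ n : ℕ, ∀ᶠ k in atTop, ∀ i ∈ Finset.range (n + 1),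
      P {ω | (1 / 2 : ℝ) ^ n ≤ dist (T (e i) k ω) (g (e i) ω)} ≤ (1 / 2 : ℝ≥0∞) ^ n := by
    intro n
    rw [eventually_all_finset]
    intro i _
    have := tendstoInMeasure_iff_dist.1 (h (e i)) ((1 / 2) ^ n) (by positivity)
    exact this.eventually_le_const (ENNReal.pow_pos (by simp) n)
  obtain ⟨ns, hns, hP⟩ := extraction_forall_of_eventually h1
  refine ⟨ns, hns, ?_⟩
  rw [ae_all_iff]
  intro j
  obtain ⟨i, rfl⟩ := he j
  have hsum : ∑' n, P {ω | (1 / 2 : ℝ) ^ (n + i) ≤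
      dist (T (e i) (ns (n + i)) ω) (g (e i) ω)} ≠ ∞ := by
    refine ne_top_of_le_ne_top (b := ∑' n : ℕ, (1 / 2 : ℝ≥0∞) ^ n) ?_ ?_
    · rw [ENNReal.tsum_geometric]
      simp
    · refine ENNReal.tsum_le_tsum fun n => (hP (n + i) i (by simp)).trans ?_
      exact pow_le_pow_right_of_le_one' (by simp) (Nat.le_add_right _ _)
  filter_upwards [ae_eventually_notMem hsum] with ω hω
  rw [← tendsto_add_atTop_iff_nat i, tendsto_iff_dist_tendsto_zero]
  have h0 : Tendsto (fun n : ℕ => (1 / 2 : ℝ) ^ (n + i)) atTop (𝓝 0) :=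
    (tendsto_add_atTop_iff_nat i).2 (tendsto_pow_atTop_nhds_zero_of_lt_one (by norm_num)
      (by norm_num))
  refine squeeze_zero' (Eventually.of_forall fun _ => dist_nonneg) ?_ h0
  filter_upwards [hω] with n hn
  exact (not_le.1 hn).le

end Subsequences

/-! ### Measurability, and existence for `f Y - f X` -/

section Processes

variable {Ω : Type*} [mΩ : MeasurableSpace Ω] {P : Measure Ω} {𝓕 : Filtration ℝ≥0 mΩ}
  {t : ℝ≥0} {D : ℕ → TimePartition t}

/-- Under the usual hypothesis, an almost sure limit of random variables that are measurable
slightly after time `s` is measurable at time `s`. -/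
theorem UsualHypothesis.measurable_of_tendsto (h𝓕 : UsualHypothesis P 𝓕) {s : ℝ≥0} {δ : ℕ → ℝ≥0}
    (hδ : Tendsto δ atTop (𝓝 0)) {Y : ℕ → Ω → ℝ} {Z : Ω → ℝ}
    (hY : ∀ k, Measurable[𝓕 (s + δ k)] (Y k))
    (hlim : ∀ᵐ ω ∂P, Tendsto (fun k => Y k ω) atTop (𝓝 (Z ω))) : Measurable[𝓕 s] Z := by
  have := h𝓕.rightContinuous
  set N : Set Ω := {ω | ¬ Tendsto (fun k => Y k ω) atTop (𝓝 (Z ω))} with hN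
  have hN0 : P N = 0 := ae_iff.1 hlim
  have hnull : ∀ r, ∀ A ⊆ N, MeasurableSet[𝓕 r] A := fun r A hA =>
    𝓕.mono zero_le _ (h𝓕.complete A (measure_mono_null hA hN0))
  -- Off the null set `N` finitely many terms are dropped to get measurability at each `r > s`, and
  -- right-continuity brings this down to `s`. Inside `N` every set is measurable by completeness.
  have hZ' : ∀ r > s, Measurable[𝓕 r] (Nᶜ.indicator Z) := by
    intro r hr
    have hev : ∀ᶠ k in atTop, δ k < r - s := hδ.eventually_lt_const (tsub_pos_of_lt hr)
    obtain ⟨k₀, hk₀⟩ := eventually_atTop.1 hev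
    refine @measurable_of_tendsto_metrizable Ω ℝ (𝓕 r) _ _ _ _
      (fun k => Nᶜ.indicator (Y (k + k₀))) _ (fun k => ?_) ?_
    · have h1 := (hk₀ (k + k₀) (Nat.le_add_left _ _)).le
      have h2 : s + δ (k + k₀) ≤ r :=
        calc s + δ (k + k₀) ≤ s + (r - s) := by gcongr
          _ = r := add_tsub_cancel_of_le hr.le
      have h3 : Measurable[𝓕 r] (Y (k + k₀)) := (hY (k + k₀)).mono (𝓕.mono h2) le_rfl
      exact h3.indicator (hnull r N subset_rfl).compl
    · rw [tendsto_pi_nhds]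
      intro ω
      by_cases hω : ω ∈ N
      · simp [hω]
      · simp only [Set.indicator_of_mem (show ω ∈ Nᶜ from hω)]
        exact (tendsto_add_atTop_iff_nat k₀).2 (not_not.1 hω)
  intro B hB
  have h1 : MeasurableSet[𝓕 s] (Nᶜ.indicator Z ⁻¹' B) := by
    refine Filtration.IsRightContinuous.measurableSet ?_
    rw [Filtration.rightCont_eq]
    simp only [MeasurableSpace.measurableSet_iInf]
    exact fun r hr => hZ' r hr hB
  have h2 : Z ⁻¹' B = (Nᶜ.indicator Z ⁻¹' B) \ N ∪ (Z ⁻¹' B) ∩ N := by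
    ext ω
    by_cases hω : ω ∈ N
    · simp [hω]
    · simp [hω]
  rw [h2]
  exact @MeasurableSet.union Ω (𝓕 s) _ _
    (@MeasurableSet.diff Ω (𝓕 s) _ _ h1 (hnull s N subset_rfl))
    (hnull s _ Set.inter_subset_right)

/-- The last increment may reach past `s`, by at most the mesh. -/
theorem TimePartition.measurable_incrSum (E : TimePartition t) {Z : ℝ≥0 → Ω → ℝ}
    (hZ : Adapted 𝓕 Z) {φ : ℝ → ℝ} (hφ : Continuous φ) (s : ℝ≥0) :
    Measurable[𝓕 (s + E.mesh)]
      (fun ω => E.incrSum (fun a b => φ (Z b ω - Z a ω)) 0 s) := by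
  unfold TimePartition.incrSum
  refine Finset.measurable_fun_sum _ fun i hi => ?_
  simp only [Finset.mem_filter, Finset.mem_range] at hi
  refine hφ.measurable.comp (Measurable.sub ?_ ?_)
  · exact hZ.measurable_le ((E.p_succ_le hi.1).trans (by gcongr; exact hi.2.2.le))
  · exact hZ.measurable_le (hi.2.2.le.trans le_self_add)

/-- A countable dense set of times that contains `t`. -/
theorem exists_countable_times (t : ℝ≥0) : ∃ S : Set ℝ≥0, S.Countable ∧ t ∈ S ∧
    ∀ a b, a < b → ∃ r ∈ S, a < r ∧ r < b := by
  obtain ⟨S, hS, hd⟩ := TopologicalSpace.exists_countable_dense ℝ≥0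
  refine ⟨insert t S, hS.insert t, Set.mem_insert _ _, fun a b hab => ?_⟩
  obtain ⟨r, hr, h⟩ := hd.exists_between hab
  exact ⟨r, Set.mem_insert_of_mem _ hr, h⟩

theorem IsQuadVar.exists_jumpDecomp {X Q : ℝ≥0 → Ω → ℝ} (h : IsQuadVar P 𝓕 D X Q) :
    ∃ Qc : ℝ≥0 → Ω → ℝ, ∀ᵐ ω ∂P,
      IsJumpDecomp t (fun s => X s ω) (fun s => Q s ω) (fun s => Qc s ω) := by
  obtain ⟨Qc, _, hQc⟩ := h.decomp
  exact ⟨Qc, hQc.mono fun ω hω => ⟨hω.1, hω.2.1, hω.2.2⟩⟩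

/-- Quadratic variations of countably many processes become pathwise quadratic variations along a
subsequence of partitions. -/
theorem exists_seq_isPathQuadVar (hD : IsRefining D) {κ : Type*} [Countable κ]
    {X Q Qc : κ → ℝ≥0 → Ω → ℝ} (hX : ∀ i, ∀ᵐ ω ∂P, IsCadlag fun s => X i s ω)
    (hQ : ∀ i, IsQuadVar P 𝓕 D (X i) (Q i))
    (hQc : ∀ i, ∀ᵐ ω ∂P,
      IsJumpDecomp t (fun s => X i s ω) (fun s => Q i s ω) (fun s => Qc i s ω))
    {ms : ℕ → ℕ} (hms : StrictMono ms) :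
    ∃ ns : ℕ → ℕ, StrictMono ns ∧ ∀ᵐ ω ∂P, ∀ i, IsPathQuadVar (map (ms ∘ ns) atTop) D
      (fun s => X i s ω) (fun s => Q i s ω) (fun s => Qc i s ω) := by
  obtain ⟨S, hSc, htS, hSd⟩ := exists_countable_times t
  have : Countable {s // s ∈ S ∩ Set.Ioc 0 t} := (hSc.mono Set.inter_subset_left).to_subtype
  obtain ⟨ns, hns, h⟩ := exists_seq_forall_tendsto_ae (P := P)
    (T := fun (j : κ × {s // s ∈ S ∩ Set.Ioc 0 t}) k ω =>
      (D (ms k)).sqSum (fun r => X j.1 r ω) j.2.1)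
    (g := fun j => Q j.1 j.2.1)
    (fun j => ((hQ j.1).tendsto _ j.2.2.2).comp hms.tendsto_atTop)
  refine ⟨ns, hns, ?_⟩
  filter_upwards [h, ae_all_iff.2 hX, ae_all_iff.2 hQc] with ω h1 h2 h3 i
  refine (h3 i).isPathQuadVar (h2 i) ?_ htS (fun a b hab _ => hSd a b hab) fun s hsS hs => ?_
  · exact hD.comp (tendsto_map'_iff.2 (hms.comp hns).tendsto_atTop)
  · rw [tendsto_map'_iff]
    refine (h1 (i, ⟨s, hsS, hs⟩)).congr fun k => ?_
    exact (D (ms (ns k))).sqSum_eq_incrSum _ hs.2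

/-- For `ε > 0` these functions ignore `|h| ≤ ε`, so their jump sums are limits of sums over
partitions; they tend to `h²` as `ε → 0`. This is how the sum of squared jumps is shown to be
adapted. -/
theorem continuous_truncSq (ε : ℝ) : Continuous fun h : ℝ => max (h ^ 2 - ε ^ 2) 0 := by fun_prop

/-- The sum of the squared jumps of an adapted process is adapted. -/
theorem UsualHypothesis.measurable_jumpSum (h𝓕 : UsualHypothesis P 𝓕) (hD : IsRefining D)
    {Z : ℝ≥0 → Ω → ℝ} (hZ : IsCadlagProcess P 𝓕 Z)
    (hsum : ∀ᵐ ω ∂P, Summable ((Set.Icc 0 t).indicator fun u => jump (fun r => Z r ω) u ^ 2))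
    {s : ℝ≥0} (hs : s ∈ Set.Ioc 0 t) :
    Measurable[𝓕 s] fun ω => jumpSum (fun r => Z r ω) s := by
  let φ : ℕ → ℝ → ℝ := fun j h => max (h ^ 2 - (1 / ((j : ℝ) + 1)) ^ 2) 0
  have hφ0 : ∀ j h, 0 ≤ φ j h := fun j h => le_max_right _ _
  have hφle : ∀ j h, φ j h ≤ h ^ 2 := fun j h =>
    max_le (by linarith [sq_nonneg (1 / ((j : ℝ) + 1))]) (sq_nonneg h)
  have hφlim : ∀ h, Tendsto (fun j => φ j h) atTop (𝓝 (h ^ 2)) := by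
    intro h
    have h1 : Tendsto (fun j : ℕ => h ^ 2 - (1 / ((j : ℝ) + 1)) ^ 2) atTop (𝓝 (h ^ 2)) := by
      simpa using (tendsto_const_nhds (x := h ^ 2)).sub
        ((tendsto_one_div_add_atTop_nhds_zero_nat (𝕜 := ℝ)).pow 2)
    have h2 := h1.max (tendsto_const_nhds (x := (0 : ℝ)))
    rwa [max_eq_left (sq_nonneg h)] at h2
  have hsub : Set.Ioc 0 s ⊆ Set.Icc 0 t := fun u hu => ⟨zero_le, hu.2.trans hs.2⟩
  have hmeas : ∀ j, Measurable[𝓕 s] fun ω =>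
      ∑' u, (Set.Ioc 0 s).indicator (fun u => φ j (jump (fun r => Z r ω) u)) u := by
    intro j
    refine h𝓕.measurable_of_tendsto hD
      (fun k => (D k).measurable_incrSum hZ.adapted (continuous_truncSq (1 / ((j : ℝ) + 1))) s) ?_
    filter_upwards [hZ.cadlag, hsum] with ω hc hsω
    have hε : (0 : ℝ) < 1 / ((j : ℝ) + 1) := by positivity
    refine hc.tendsto_incrSum_jump hD (continuous_truncSq (1 / ((j : ℝ) + 1))) hε (fun h hh => ?_)
      ?_ hs
    · rw [max_eq_right]
      have := sq_le_sq' (neg_le_of_abs_le hh) (le_of_abs_le hh)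
      linarith
    · refine hsω.of_nonneg_of_le (fun u => Set.indicator_nonneg (fun u _ => hφ0 j _) u) fun u => ?_
      exact Set.indicator_le_indicator (hφle j _)
  refine h𝓕.measurable_of_tendsto (δ := fun _ => 0) tendsto_const_nhds
    (fun j => by rw [add_zero]; exact hmeas j) ?_
  filter_upwards [hsum] with ω hsω
  have h1 := jumpSum_sub hsω zero_le hs.2
  rw [jumpSum_zero, sub_zero] at h1
  rw [h1]
  refine tendsto_tsum_of_dominated_convergence (summable_indicator_Icc hsω hsub) (fun u => ?_)
    (Eventually.of_forall fun j u => ?_)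
  · by_cases hu : u ∈ Set.Ioc 0 s
    · simp only [Set.indicator_of_mem hu]
      exact hφlim _
    · simp only [Set.indicator_of_notMem hu]
      exact tendsto_const_nhds
  · by_cases hu : u ∈ Set.Ioc 0 s
    · simp only [Set.indicator_of_mem hu]
      rw [Real.norm_of_nonneg (hφ0 j _)]
      exact hφle j _
    · simp only [Set.indicator_of_notMem hu, norm_zero, le_refl]

theorem IsCadlagProcess.comp_sub {X Y : ℝ≥0 → Ω → ℝ} (hX : IsCadlagProcess P 𝓕 X)
    (hY : IsCadlagProcess P 𝓕 Y) {f : ℝ → ℝ} (hf : Continuous f) :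
    IsCadlagProcess P 𝓕 fun s ω => f (Y s ω) - f (X s ω) where
  adapted s := (hf.measurable.comp (hY.adapted s)).sub (hf.measurable.comp (hX.adapted s))
  cadlag := by
    filter_upwards [hX.cadlag, hY.cadlag] with ω hx hy
    exact (hy.comp hf).sub (hx.comp hf)

/-- If `X`, `Y` and `Y - X` admit quadratic variations, then so does `f Y - f X`. -/
theorem HasQuadVar.comp_sub [IsProbabilityMeasure P] (h𝓕 : UsualHypothesis P 𝓕) (ht : 0 < t)
    (hD : IsRefining D) {X Y : ℝ≥0 → Ω → ℝ} (hX : IsCadlagProcess P 𝓕 X)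
    (hY : IsCadlagProcess P 𝓕 Y) (hXQ : HasQuadVar P 𝓕 D X) (hYQ : HasQuadVar P 𝓕 D Y)
    (hWQ : HasQuadVar P 𝓕 D fun s ω => Y s ω - X s ω) {f : ℝ → ℝ} (hf : ContDiff ℝ 2 f) :
    HasQuadVar P 𝓕 D fun s ω => f (Y s ω) - f (X s ω) := by
  obtain ⟨QX, hQX⟩ := hXQ
  obtain ⟨QY, hQY⟩ := hYQ
  obtain ⟨QW, hQW⟩ := hWQ
  obtain ⟨CX, hCX⟩ := hQX.exists_jumpDecomp
  obtain ⟨CY, hCY⟩ := hQY.exists_jumpDecomp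
  obtain ⟨CW, hCW⟩ := hQW.exists_jumpDecomp
  have hf1 : ContDiff ℝ 1 f := hf.of_le one_le_two
  have hZ := hX.comp_sub hY hf.continuous
  set Z : ℝ≥0 → Ω → ℝ := fun s ω => f (Y s ω) - f (X s ω) with hZdef
  have hW : ∀ᵐ ω ∂P, IsCadlag fun s => Y s ω - X s ω := by
    filter_upwards [hX.cadlag, hY.cadlag] with ω hx hy using hy.sub hx
  have hseq : ∀ ms : ℕ → ℕ, StrictMono ms → ∃ ns : ℕ → ℕ, StrictMono ns ∧ ∀ᵐ ω ∂P,
      IsPathQuadVar (map (ms ∘ ns) atTop) D (fun s => X s ω) (fun s => QX s ω) (fun s => CX s ω) ∧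
      IsPathQuadVar (map (ms ∘ ns) atTop) D (fun s => Y s ω) (fun s => QY s ω) (fun s => CY s ω) ∧
      IsPathQuadVar (map (ms ∘ ns) atTop) D (fun s => Y s ω - X s ω) (fun s => QW s ω)
        (fun s => CW s ω) := by
    intro ms hms
    obtain ⟨ns, hns, h⟩ := exists_seq_isPathQuadVar (P := P) (𝓕 := 𝓕) hD (κ := Fin 3)
      (X := ![X, Y, fun s ω => Y s ω - X s ω]) (Q := ![QX, QY, QW]) (Qc := ![CX, CY, CW])
      (by rw [Fin.forall_fin_succ, Fin.forall_fin_two]; exact ⟨hX.cadlag, hY.cadlag, hW⟩)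
      (by rw [Fin.forall_fin_succ, Fin.forall_fin_two]; exact ⟨hQX, hQY, hQW⟩)
      (by rw [Fin.forall_fin_succ, Fin.forall_fin_two]; exact ⟨hCX, hCY, hCW⟩) hms
    exact ⟨ns, hns, h.mono fun ω hω => ⟨hω 0, hω 1, hω 2⟩⟩
  have hmesh : ∀ {l : Filter ℕ}, l ≤ atTop → Tendsto (fun k => (D k).mesh) l (𝓝 0) :=
    fun hl => Tendsto.mono_left hD hl
  obtain ⟨ns, hns, hgood⟩ := hseq id strictMono_id
  have hle : map (id ∘ ns) atTop ≤ atTop := hns.tendsto_atTop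
  set l := map (id ∘ ns) atTop with hl
  let V : ℝ≥0 → Ω → ℝ := fun s ω =>
    if 0 < s ∧ s ≤ t then limUnder l fun k => (D k).incrSum (sqIncr fun r => Z r ω) 0 s else 0
  have hV : ∀ᵐ ω ∂P, ∀ s ∈ Set.Ioc 0 t,
      Tendsto (fun k => (D k).incrSum (sqIncr fun r => Z r ω) 0 s) l (𝓝 (V s ω)) := by
    filter_upwards [hgood, hX.cadlag, hY.cadlag] with ω hω hx hy s hs
    obtain ⟨v, hv⟩ := IsPathQuadVar.exists_tendsto_comp_sub (hmesh hle) hx hy hω.1 hω.2.1 hω.2.2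
      hf1 hs
    have h1 : V s ω = limUnder l fun k => (D k).incrSum (sqIncr fun r => Z r ω) 0 s := if_pos hs
    rw [h1]
    exact tendsto_nhds_limUnder ⟨v, hv⟩
  have hdec : ∀ᵐ ω ∂P,
      IsJumpDecomp t (fun s => Z s ω) (fun s => V s ω)
        (contPart t (fun s => Z s ω) (fun s => V s ω)) ∧
      Tendsto (fun j : ℕ => V (t / (j + 1)) ω - jumpSum (fun s => Z s ω) (t / (j + 1))) atTop
        (𝓝 (contPart t (fun s => Z s ω) (fun s => V s ω) 0)) := by
    filter_upwards [hgood, hX.cadlag, hY.cadlag, hZ.cadlag, hV] with ω hω hx hy hz hv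
    obtain ⟨Bx, hBx⟩ := hx.exists_bound ht
    obtain ⟨By, hBy⟩ := hy.exists_bound ht
    obtain ⟨K, hK⟩ := exists_sq_difference_le hf (max Bx By)
    have hBx' := fun s hs => (hBx s hs).trans (le_max_left Bx By)
    have hBy' := fun s hs => (hBy s hs).trans (le_max_right Bx By)
    exact isJumpDecomp_contPart (hmesh hle) ht hx hy hz hω.1 hω.2.1
      (fun a b ha hb => hK _ _ _ _ (hBx' a ha) (hBx' b hb) (hBy' a ha) (hBy' b hb)) hv
  have hJ : ∀ s ∈ Set.Ioc 0 t, Measurable[𝓕 s] fun ω => jumpSum (fun r => Z r ω) s :=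
    fun s hs => h𝓕.measurable_jumpSum hD hZ (hdec.mono fun ω hω => hω.1.summable ht) hs
  have hVmeas : Adapted 𝓕 V := by
    intro s
    by_cases hs : 0 < s ∧ s ≤ t
    · refine h𝓕.measurable_of_tendsto (δ := fun k => (D (ns k)).mesh)
        ((hmesh hle).comp tendsto_map) (fun k => (D (ns k)).measurable_incrSum hZ.adapted
          (continuous_pow 2) s) ?_
      filter_upwards [hV] with ω hω
      exact tendsto_map'_iff.1 (hω s hs)
    · have : V s = fun _ => 0 := by
        funext ω
        exact if_neg hs
      rw [this]
      exact measurable_const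
  have hseq0 : Tendsto (fun j : ℕ => t / ((j : ℝ≥0) + 1)) atTop (𝓝 0) := by
    simpa [div_eq_mul_inv] using
      (tendsto_one_div_add_atTop_nhds_zero_nat (𝕜 := ℝ≥0)).const_mul t
  refine ⟨V, hVmeas, ⟨fun s ω =>
    if s ≤ t then contPart t (fun s => Z s ω) (fun s => V s ω) s else 0, fun s => ?_, ?_⟩, ?_⟩
  · by_cases hst : s ≤ t
    · simp only [if_pos hst]
      rcases eq_or_ne s 0 with rfl | hs0
      · refine h𝓕.measurable_of_tendsto hseq0 (fun j => ?_) (hdec.mono fun ω hω => hω.2)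
        rw [zero_add]
        refine (hVmeas _).sub (hJ _ ⟨div_pos ht (by positivity), ?_⟩)
        exact div_le_self zero_le (by simp)
      · have : (fun ω => contPart t (fun s => Z s ω) (fun s => V s ω) s) =
            fun ω => V s ω - jumpSum (fun r => Z r ω) s := by
          funext ω
          rw [contPart, if_neg hs0]
        rw [this]
        exact (hVmeas s).sub (hJ s ⟨pos_iff_ne_zero.2 hs0, hst⟩)
    · simp only [if_neg hst]
      exact measurable_const
  · filter_upwards [hdec] with ω hω
    have heq : Set.EqOn (fun s => if s ≤ t then contPart t (fun s => Z s ω) (fun s => V s ω) s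
        else 0) (contPart t (fun s => Z s ω) (fun s => V s ω)) (Set.Icc 0 t) :=
      fun s hs => if_pos hs.2
    refine ⟨hω.1.cont.congr heq, hω.1.mono.congr heq.symm, fun s hs => ?_⟩
    rw [if_pos hs.2]
    exact hω.1.hasSum s hs
  · intro s hs
    -- Convergence in probability holds if every subsequence has a further one that converges almost
    -- surely to `V s`.
    refine (exists_seq_tendstoInMeasure_atTop_iff fun k => ?_).2 fun ms hms => ?_
    · have h1 := (D k).measurable_incrSum hZ.adapted (continuous_pow 2) s
      have h2 : (fun ω => (D k).sqSum (fun r => Z r ω) s) =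
          fun ω => (D k).incrSum (fun a b => (Z b ω - Z a ω) ^ 2) 0 s :=
        funext fun ω => (D k).sqSum_eq_incrSum _ hs.2
      rw [h2]
      exact (h1.mono (𝓕.le _) le_rfl).aestronglyMeasurable
    · obtain ⟨ns', hns', hgood'⟩ := hseq ms hms
      refine ⟨ns', hns', ?_⟩
      filter_upwards [hgood, hgood', hX.cadlag, hY.cadlag, hV] with ω hω hω' hx hy hv
      have hle' : map (ms ∘ ns') atTop ≤ atTop := (hms.comp hns').tendsto_atTop
      -- The inputs have the same limits along both subsequences, hence along the join of the two
      -- filters. The sums for `Z` therefore converge along the join, which identifies the new limit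
      -- with `V s`.
      obtain ⟨v, hv'⟩ := IsPathQuadVar.exists_tendsto_comp_sub
        (l := l ⊔ map (ms ∘ ns') atTop) (D := D) (hmesh (sup_le hle hle')) hx hy
        ⟨hω.1.toIsJumpDecomp, fun s hs => (hω.1.tendsto s hs).sup (hω'.1.tendsto s hs)⟩
        ⟨hω.2.1.toIsJumpDecomp, fun s hs => (hω.2.1.tendsto s hs).sup (hω'.2.1.tendsto s hs)⟩
        ⟨hω.2.2.toIsJumpDecomp, fun s hs => (hω.2.2.tendsto s hs).sup (hω'.2.2.tendsto s hs)⟩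
        hf1 hs
      have h1 : V s ω = v := tendsto_nhds_unique (hv s hs) (hv'.mono_left le_sup_left)
      rw [h1]
      refine (tendsto_map'_iff.1 (hv'.mono_left le_sup_right)).congr fun k => ?_
      rw [(D (ms (ns' k))).sqSum_eq_incrSum _ hs.2]
      rfl

end Processes

/-! ### Convergence to zero -/

/-- Pathwise convergence to zero of the quadratic variations of `f (y n) - f x`. -/
theorem tendsto_zero_of_isPathQuadVar {t : ℝ≥0} (ht : 0 < t) {D : ℕ → TimePartition t}
    {l : ℕ → Filter ℕ} [∀ n, (l n).NeBot] (hD : ∀ n, Tendsto (fun k => (D k).mesh) (l n) (𝓝 0))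
    {x q qc : ℝ≥0 → ℝ} {y qw qcw : ℕ → ℝ≥0 → ℝ} {v : ℕ → ℝ} (hxc : IsCadlag x)
    (hyc : ∀ n, IsCadlag (y n)) (hx : ∀ n, IsPathQuadVar (l n) D x q qc)
    (hw : ∀ n, IsPathQuadVar (l n) D (fun s => y n s - x s) (qw n) (qcw n)) {f : ℝ → ℝ}
    (hf : ContDiff ℝ 2 f)
    (hv : ∀ n, Tendsto (fun k => (D k).incrSum (sqIncr fun s => f (y n s) - f (x s)) 0 t) (l n)
      (𝓝 (v n)))
    (hqw : Tendsto (fun n => qw n t) atTop (𝓝 0))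
    (hconv : ∀ s ≤ t, Tendsto (fun n => y n s) atTop (𝓝 (x s))) {B : ℝ}
    (hB : ∀ n, ∀ s ≤ t, |y n s| ≤ B) : Tendsto v atTop (𝓝 0) := by
  have hxB : ∀ s ≤ t, |x s| ≤ B := fun s hs =>
    le_of_tendsto' (hconv s hs).abs fun n => hB n s hs
  obtain ⟨K, hK, hKf⟩ := exists_sq_second_difference_le hf B
  have hwc : ∀ n, IsCadlag fun s => y n s - x s := fun n => (hyc n).sub hxc
  let G : ℕ → ℝ≥0 → ℝ := fun n s => (y n s - x s) ^ 2
  have hGc : ∀ n, IsCadlag (G n) := fun n => (hwc n).comp (continuous_pow 2)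
  have hG0 : ∀ s ≤ t, Tendsto (fun n => G n s) atTop (𝓝 0) := by
    intro s hs
    simpa using ((hconv s hs).sub_const (x s)).pow 2
  have hGB : ∀ n, ∀ s ≤ t, |G n s| ≤ (2 * B) ^ 2 := by
    intro n s hs
    rw [abs_pow]
    have := abs_sub (y n s) (x s)
    have := hB n s hs
    have := hxB s hs
    gcongr
    linarith
  have hjump : ∀ n u, 0 < u → u ≤ t → jump (fun s => y n s - x s) u ^ 2 ≤ qw n t := by
    intro n u hu hut
    have := TimePartition.sum_jump_le_of_tendsto (hD n) (fun a b _ _ => sqIncr_nonneg _ a b) le_rfl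
      ((hw n).tendsto t ⟨ht, le_rfl⟩) {u} (by simpa using ⟨hu, hut⟩)
      (fun u => jump (fun s => y n s - x s) u ^ 2)
      (by simpa using (hwc n).tendsto_sqIncr (hD n) hu hut)
    simpa using this
  -- Pointwise convergence does not control left limits; the bound on the jumps does, through `w₋² ≤
  -- 2 (w² + (Δw)²)`.
  have hleft : ∀ u, 0 < u → u ≤ t →
      Tendsto (fun n => Function.leftLim (G n) u) atTop (𝓝 0) := by
    intro u hu hut
    have h1 : Tendsto (fun n => jump (fun s => y n s - x s) u ^ 2) atTop (𝓝 0) :=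
      squeeze_zero (fun n => sq_nonneg _) (fun n => hjump n u hu hut) hqw
    have h2 : Tendsto (fun n => 2 * (G n u + jump (fun s => y n s - x s) u ^ 2)) atTop (𝓝 0) := by
      simpa using ((hG0 u hut).add h1).const_mul 2
    have h3 : ∀ n, Function.leftLim (G n) u = Function.leftLim (fun s => y n s - x s) u ^ 2 :=
      fun n => (hwc n).leftLim_comp (continuous_pow 2) u
    refine squeeze_zero (fun n => ?_) (fun n => ?_) h2
    · rw [h3]
      exact sq_nonneg _
    · rw [h3]
      simp only [G, jump]
      nlinarith [sq_nonneg (2 * (y n u - x u) - Function.leftLim (fun s => y n s - x s) u)]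
  -- The Stieltjes function depends on `q`, `qc` and `t` but not on the filter, so one measure
  -- serves all `n`.
  set μ := ((hx 0).stieltjes ht).measure with hμ
  have hint : Tendsto (fun n => ∫ u in Set.Ioc 0 t, Function.leftLim (G n) u ∂μ) atTop (𝓝 0) := by
    have h1 := tendsto_integral_of_dominated_convergence (μ := μ.restrict (Set.Ioc 0 t))
      (F := fun n => Function.leftLim (G n)) (f := fun _ => 0) (fun _ => (2 * B) ^ 2)
      (fun n => (hGc n).measurable_leftLim.aestronglyMeasurable)
      (integrableOn_const ((hx 0).measure_Ioc_lt_top ht 0 t).ne)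
      (fun n => (ae_restrict_iff' measurableSet_Ioc).2 (Eventually.of_forall fun u hu =>
        (hGc n).abs_leftLim_le (hGB n) hu.2))
      ((ae_restrict_iff' measurableSet_Ioc).2 (Eventually.of_forall fun u hu =>
        hleft u hu.1 hu.2))
    simpa using h1
  have hle : ∀ n, v n ≤ K * (qw n t +
      ((∫ u in Set.Ioc 0 t, Function.leftLim (G n) u ∂μ) + G n 0 * qc 0)) := by
    intro n
    refine le_of_forall_pos_le_add fun ε hε => ?_
    have h1 := (hx n).eventually_weighted_le ht (hGc n)
      -- Two such errors, multiplied by `K`, add up to at most `ε`; `K + 1` avoids dividing by zero.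
      (show 0 < ε / (2 * (K + 1)) by positivity)
    have h2 := ((hw n).tendsto t ⟨ht, le_rfl⟩).eventually_lt_const
      (lt_add_of_pos_right _ (show 0 < ε / (2 * (K + 1)) by positivity))
    refine le_of_tendsto (hv n) ?_
    filter_upwards [h1, h2] with k hk1 hk2
    calc (D k).incrSum (sqIncr fun s => f (y n s) - f (x s)) 0 t
        ≤ (D k).incrSum (fun a b => K * (sqIncr (fun s => y n s - x s) a b +
            G n a * sqIncr x a b)) 0 t := by
          refine (D k).incrSum_le fun i hi _ _ => ?_
          have ha := (D k).p_le hi.le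
          have hb := (D k).p_le (show i + 1 ≤ (D k).n from hi)
          exact hKf _ _ _ _ (hxB _ ha) (hxB _ hb) (hB n _ ha) (hB n _ hb)
      _ = K * ((D k).incrSum (sqIncr (fun s => y n s - x s)) 0 t +
            (D k).incrSum (fun a b => G n a * sqIncr x a b) 0 t) := by
          rw [(D k).incrSum_const_mul, (D k).incrSum_add]
      _ ≤ K * ((qw n t + ε / (2 * (K + 1))) +
            ((∫ u in Set.Ioc 0 t, Function.leftLim (G n) u ∂μ) + G n 0 * qc 0 +
              ε / (2 * (K + 1)))) := by
          gcongr
          exact hk1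
      _ = K * (qw n t + ((∫ u in Set.Ioc 0 t, Function.leftLim (G n) u ∂μ) + G n 0 * qc 0)) +
            K / (K + 1) * ε := by
          field_simp
          ring
      _ ≤ _ := by
          gcongr
          refine mul_le_of_le_one_left hε.le ?_
          rw [div_le_one (by positivity)]
          linarith
  refine squeeze_zero (fun n => ge_of_tendsto' (hv n) fun k =>
    (D k).incrSum_nonneg (sqIncr_nonneg _) _ _) hle ?_
  simpa using (hqw.add (hint.add ((hG0 0 zero_le).mul_const (qc 0)))).const_mul K

/-- A sequence of cadlag processes that is, as a whole, bounded in probability is almost surely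
uniformly bounded. -/
theorem SeqBoundedInProbability.exists_bound {Ω : Type*} [mΩ : MeasurableSpace Ω] {P : Measure Ω}
    [IsProbabilityMeasure P] {𝓕 : Filtration ℝ≥0 mΩ} {t : ℝ≥0} {X : ℕ → ℝ≥0 → Ω → ℝ}
    (hX : ∀ n, IsCadlagProcess P 𝓕 (X n))
    (h : SeqBoundedInProbability P fun n => supProcess (X n) t) :
    ∀ᵐ ω ∂P, ∃ B, ∀ n, ∀ s ≤ t, |X n s ω| ≤ B := by
  obtain ⟨S, hSc, htS, hSd⟩ := exists_countable_times t
  have hSc' : (S ∩ Set.Icc 0 t).Countable := hSc.mono Set.inter_subset_left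
  -- The supremum over countably many times is measurable, which turns probability one into an
  -- almost sure statement. Right-continuity recovers all `s < t`, while `t` itself is put in `S`.
  let G : Ω → ℝ≥0∞ := fun ω => ⨆ n, ⨆ s ∈ S ∩ Set.Icc 0 t, ‖X n s ω‖ₑ
  have hG : Measurable G := by
    refine Measurable.iSup fun n => Measurable.biSup _ hSc' fun s _ => ?_
    exact ((hX n).adapted.measurable (i := s)).enorm
  have hle : 1 ≤ P {ω | G ω < ∞} := by
    refine le_of_tendsto' h fun R => measure_mono fun ω hω => ?_
    refine lt_of_le_of_lt ?_ (ENNReal.coe_lt_top (r := R))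
    refine le_trans ?_ (show (⨆ n, supProcess (X n) t ω) ≤ R from hω)
    exact iSup_mono fun n => biSup_mono fun s hs => hs.2
  have hae : ∀ᵐ ω ∂P, G ω < ∞ := by
    have hms : MeasurableSet {ω | G ω < ∞} := measurableSet_lt hG measurable_const
    exact (prob_compl_eq_zero_iff hms).2 (le_antisymm prob_le_one hle)
  filter_upwards [hae, ae_all_iff.2 fun n => (hX n).cadlag] with ω hω hc
  have hS : ∀ n, ∀ s ∈ S, s ≤ t → |X n s ω| ≤ (G ω).toReal := by
    intro n s hs hst
    have h1 : ‖X n s ω‖ₑ ≤ G ω :=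
      (le_biSup (fun s => ‖X n s ω‖ₑ) (show s ∈ S ∩ Set.Icc 0 t from ⟨hs, zero_le, hst⟩)).trans
        (le_iSup (fun n => ⨆ s ∈ S ∩ Set.Icc 0 t, ‖X n s ω‖ₑ) n)
    have h2 := ENNReal.toReal_mono hω.ne h1
    rwa [toReal_enorm] at h2
  refine ⟨(G ω).toReal, fun n s hs => ?_⟩
  rcases hs.eq_or_lt with rfl | hst
  · exact hS n s htS le_rfl
  · by_contra! hlt
    obtain ⟨s₁, hs₁, h1⟩ := (hc n).exists_right s (sub_pos.2 hlt)
    obtain ⟨r, hr, hr1, hr2⟩ := hSd s (min s₁ t) (lt_min hs₁ hst)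
    have h2 := h1 r hr1.le (hr2.trans_le (min_le_left _ _))
    have h3 := hS n r hr (hr2.trans_le (min_le_right _ _)).le
    have h4 := abs_sub_abs_le_abs_sub (X n s ω) (X n r ω)
    rw [abs_sub_comm] at h4
    linarith

/-- The limit is claimed for arbitrary versions `V n`, quadratic variations being determined only up
to null sets at each time. -/
theorem mainTheorem5 {Ω : Type*} [mΩ : MeasurableSpace Ω] (P : Measure Ω)
    [IsProbabilityMeasure P] (𝓕 : Filtration ℝ≥0 mΩ) (h𝓕 : UsualHypothesis P 𝓕)
    (t : ℝ≥0) (ht : 0 < t)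
    (D : ℕ → TimePartition t) (hD : IsRefining D)
    (X : ℝ≥0 → Ω → ℝ) (Xn : ℕ → ℝ≥0 → Ω → ℝ)
    (hX : IsCadlagProcess P 𝓕 X) (hXn : ∀ n, IsCadlagProcess P 𝓕 (Xn n))
    (hXQ : HasQuadVar P 𝓕 D X) (hXnQ : ∀ n, HasQuadVar P 𝓕 D (Xn n))
    (Q : ℕ → ℝ≥0 → Ω → ℝ)
    (hQ : ∀ n, IsQuadVar P 𝓕 D (fun s ω => Xn n s ω - X s ω) (Q n))
    (hQ0 : ∀ᵐ ω ∂P, Tendsto (fun n => Q n t ω) atTop (𝓝 0))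
    (hconv : ∀ᵐ ω ∂P, ∀ s ≤ t, Tendsto (fun n => Xn n s ω) atTop (𝓝 (X s ω)))
    (hbdd : SeqBoundedInProbability P (fun n => supProcess (Xn n) t))
    (f : ℝ → ℝ) (hf : ContDiff ℝ 2 f) :
    (∀ n, HasQuadVar P 𝓕 D (fun s ω => f (Xn n s ω) - f (X s ω))) ∧
    ∀ V : ℕ → ℝ≥0 → Ω → ℝ,
      (∀ n, IsQuadVar P 𝓕 D (fun s ω => f (Xn n s ω) - f (X s ω)) (V n)) →
      ∀ᵐ ω ∂P, Tendsto (fun n => V n t ω) atTop (𝓝 0) := by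
  refine ⟨fun n => HasQuadVar.comp_sub h𝓕 ht hD hX (hXn n) hXQ (hXnQ n) ⟨Q n, hQ n⟩ hf,
    fun V hV => ?_⟩
  obtain ⟨QX, hQX⟩ := hXQ
  obtain ⟨CX, hCX⟩ := hQX.exists_jumpDecomp
  choose CW hCW using fun n => (hQ n).exists_jumpDecomp
  choose CZ hCZ using fun n => (hV n).exists_jumpDecomp
  have hW : ∀ n, ∀ᵐ ω ∂P, IsCadlag fun s => Xn n s ω - X s ω := by
    intro n
    filter_upwards [hX.cadlag, (hXn n).cadlag] with ω hx hy using hy.sub hx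
  -- The subsequence may depend on `n`, since the pathwise statement allows a separate filter for
  -- each `n`.
  have hseq : ∀ n, ∃ ns : ℕ → ℕ, StrictMono ns ∧ ∀ᵐ ω ∂P,
      IsPathQuadVar (map ns atTop) D (fun s => X s ω) (fun s => QX s ω) (fun s => CX s ω) ∧
      IsPathQuadVar (map ns atTop) D (fun s => Xn n s ω - X s ω) (fun s => Q n s ω)
        (fun s => CW n s ω) ∧
      IsPathQuadVar (map ns atTop) D (fun s => f (Xn n s ω) - f (X s ω)) (fun s => V n s ω)
        (fun s => CZ n s ω) := by
    intro n
    obtain ⟨ns, hns, h⟩ := exists_seq_isPathQuadVar (P := P) (𝓕 := 𝓕) hD (κ := Fin 3)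
      (X := ![X, fun s ω => Xn n s ω - X s ω, fun s ω => f (Xn n s ω) - f (X s ω)])
      (Q := ![QX, Q n, V n]) (Qc := ![CX, CW n, CZ n])
      (by rw [Fin.forall_fin_succ, Fin.forall_fin_two]
          exact ⟨hX.cadlag, hW n, (hX.comp_sub (hXn n) hf.continuous).cadlag⟩)
      (by rw [Fin.forall_fin_succ, Fin.forall_fin_two]; exact ⟨hQX, hQ n, hV n⟩)
      (by rw [Fin.forall_fin_succ, Fin.forall_fin_two]; exact ⟨hCX, hCW n, hCZ n⟩) strictMono_id
    exact ⟨ns, hns, h.mono fun ω hω => ⟨hω 0, hω 1, hω 2⟩⟩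
  choose ns hns hgood using hseq
  filter_upwards [ae_all_iff.2 hgood, hX.cadlag, ae_all_iff.2 fun n => (hXn n).cadlag, hQ0, hconv,
    hbdd.exists_bound hXn] with ω hω hx hy hq hc ⟨B, hB⟩
  exact tendsto_zero_of_isPathQuadVar ht (l := fun n => map (ns n) atTop)
    (fun n => Tendsto.mono_left hD (hns n).tendsto_atTop) hx hy (fun n => (hω n).1)
    (fun n => (hω n).2.1) hf (fun n => (hω n).2.2.tendsto t ⟨ht, le_rfl⟩) hq hc hB
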